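/- Work in homotopy type theory, that is, Martin-Löf type theory with a cumulative hierarchy of universes $\mathcal U_0 : \mathcal U_1 : \cdots$, function extensionality, univalence, propositional truncation $\|\cdot\|$ and quotient inductive-inductive types; $\exists(x{:}A).B(x)$ stands for $\|\Sigma(x{:}A).B(x)\|$, $\mathsf{Dec}(A)$ for $A \uplus \neg A$, and $A \leftrightarrow B$ for $(A \to B) \times (B \to A)$. Let the set $\mathsf{Brw} : \mathcal U_0$ of Brouwer trees and the proposition-valued relation $\le$ on it be the quotient inductive-inductive type generated simultaneously by $$\mathsf{zero} : \mathsf{Brw}, \qquad \mathsf{succ} : \mathsf{Brw} \to \mathsf{Brw}, \qquad \mathsf{limit} : (\mathbb N \xrightarrow{<} \mathsf{Brw}) \to \mathsf{Brw}, \qquad \mathsf{bisim} : \forall f\, g.\ f \approx g \to \mathsf{limit}\, f = \mathsf{limit}\, g,$$ $$\mathsf{zero} \le x, \qquad x \le y \to y \le z \to x \le z, \qquad x \le y \to \mathsf{succ}\, x \le \mathsf{succ}\, y,$$ $$\forall k.\ \bigl(x \le f(k) \to x \le \mathsf{limit}\, f\bigr), \qquad \bigl(\forall k.\ f(k) \le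 x\bigr) \to \mathsf{limit}\, f \le x,$$ where $x < y$ means $\mathsf{succ}\, x \le y$, $\mathbb N \xrightarrow{<} \mathsf{Brw}$ is the type of sequences $f$ with $f(k) < f(k+1)$ for all $k$, and $f \approx g$ means that $\forall k.\exists n.\ f(k) \le g(n)$ and $\forall k.\exists n.\ g(k) \le f(n)$. Let $\omega := \mathsf{limit}\,\iota$, where $\iota(0) = \mathsf{zero}$ and $\iota(n+1) = \mathsf{succ}(\iota(n))$, and let $\mathsf{WLPO}$ be the type $$\forall (s : \mathbb N \to \mathbf 2).\ (\forall n.\ s_n = \mathsf{ff}) \uplus \neg(\forall n.\ s_n = \mathsf{ff}).$$ Then $\mathsf{Brw}$ has locally decidable equality at $\omega$ if and only if $\mathsf{WLPO}$ holds; that is, the closed type $$\mathsf{WLPO} \;\leftrightarrow\; \forall (x : \mathsf{Brw}).\ \mathsf{Dec}(x = \omega)$$ is inhabited (has a closed element) in this type theory. -/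

import Mathlib

/-!
# Homotopy type theory, and the quotient inductive-inductive type of Brouwer trees

Statements such as "`A` holds if and only if `WLPO` holds" carry no content in classical
logic. They are therefore stated about the formal system in which they are meant: Martin-Löf
type theory with a cumulative hierarchy of universes, function extensionality, univalence,
propositional truncation, and the quotient inductive-inductive type of Brouwer trees. The
definitions below give its raw terms, its judgemental equality and its typing relation. "The
type `A` holds" means that some closed term has type `A`.
-/

namespace HoTT

/-- The primitive constants. Natural-number arguments are universe levels: the first is the
level of the parameter types, the last one of an induction principle is that of the motive.
`brwInd` and `leqInd` are the two components of the simultaneous induction principle of Brouwer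
trees and their order; their two levels are those of the motives over `Brw` and over `≤`. -/
inductive Const : Type
  -- empty type, unit type, type of two elements, natural numbers
  | empty | emptyInd (j : ℕ)
  | unit | star | unitInd (j : ℕ)
  | two | ff | tt | twoInd (j : ℕ)
  | nat | zero | suc | natInd (j : ℕ)
  -- sum types, types of dependent pairs, identity types
  | sum (i : ℕ) | inl (i : ℕ) | inr (i : ℕ) | sumInd (i j : ℕ)
  | sigma (i : ℕ) | pair (i : ℕ) | sigmaInd (i j : ℕ)
  | id (i : ℕ) | refl (i : ℕ) | idInd (i j : ℕ)
  -- propositional truncation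
  | trunc (i : ℕ) | tr (i : ℕ) | trEq (i : ℕ) | truncInd (i j : ℕ)
  -- function extensionality and univalence
  | funext (i : ℕ) | univalence (i : ℕ)
  -- Brouwer trees
  | brw | bzero | bsucc | blimit | bisim | brwSet
  | leq | leqZero | leqTrans | leqSuccMono | leqCocone | leqLimiting | leqProp
  | brwInd (i j : ℕ) | leqInd (i j : ℕ)
  deriving DecidableEq

/-- Raw terms, with de Bruijn indices; `lam A b` is `λ (x : A). b`, and universes are à la
Russell. -/
inductive Tm : Type
  | var (n : ℕ)
  | univ (i : ℕ)
  | pi (A B : Tm)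
  | lam (A b : Tm)
  | app (f a : Tm)
  | const (c : Const)
  deriving DecidableEq

namespace Tm

/-- Extension of a renaming under a binder. -/
def upRen (r : ℕ → ℕ) : ℕ → ℕ
  | 0 => 0
  | n + 1 => r n + 1

/-- Renaming of variables. -/
def rename : (ℕ → ℕ) → Tm → Tm
  | r, var n => var (r n)
  | _, univ i => univ i
  | r, pi A B => pi (rename r A) (rename (upRen r) B)
  | r, lam A b => lam (rename r A) (rename (upRen r) b)
  | r, app f a => app (rename r f) (rename r a)
  | _, const c => const c

/-- Weakening by `k` variables. -/
def lift (k : ℕ) (t : Tm) : Tm := rename (fun n => n + k) t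

/-- Extension of a substitution under a binder. -/
def up (s : ℕ → Tm) : ℕ → Tm
  | 0 => var 0
  | n + 1 => lift 1 (s n)

/-- Simultaneous capture-avoiding substitution. -/
def subst : (ℕ → Tm) → Tm → Tm
  | s, var n => s n
  | _, univ i => univ i
  | s, pi A B => pi (subst s A) (subst (up s) B)
  | s, lam A b => lam (subst s A) (subst (up s) b)
  | s, app f a => app (subst s f) (subst s a)
  | _, const c => const c

/-- The substitution of `a` for the variable `0`. -/
def single (a : Tm) : ℕ → Tm
  | 0 => a
  | n + 1 => var n

/-- `b[a]`: substitution of `a` for the variable `0` of `b`. -/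
def inst (b a : Tm) : Tm := subst (single a) b

end Tm

/-! ### Writing terms with named variables

An `Ex` is a term given at every depth, the depth being the number of binders around it. It
lets binders be written with Lean's bound variables; `e 0` is the term that `e` denotes at the
root. -/

/-- A term as a function of the number of binders it is placed under. -/
abbrev Ex : Type := ℕ → Tm

/-- The variable bound at depth `l`, seen from depth `d > l`. -/
def bvar (l : ℕ) : Ex := fun d => .var (d - 1 - l)
/-- `Π (x : A). B x` -/
def Pi (A : Ex) (B : Ex → Ex) : Ex := fun d => .pi (A d) (B (bvar d) (d + 1))
/-- `λ (x : A). b x` -/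
def Lam (A : Ex) (b : Ex → Ex) : Ex := fun d => .lam (A d) (b (bvar d) (d + 1))
/-- Application. -/
def Ap (f a : Ex) : Ex := fun d => .app (f d) (a d)
/-- A constant. -/
def C (c : Const) : Ex := fun _ => .const c
/-- The universe `U_i`. -/
def U (i : ℕ) : Ex := fun _ => .univ i
/-- A raw term at the root, weakened to the current depth. -/
def emb (t : Tm) : Ex
  | 0 => t
  | d + 1 => t.lift (d + 1)

infixl:70 " ⬝ " => Ap

/-- Non-dependent functions. -/
def Arr (A B : Ex) : Ex := Pi A fun _ => B

infixr:60 " ⇒ " => Arr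

/-! ### Derived notions of type theory -/

def Nat' : Ex := C .nat
def S (n : Ex) : Ex := C .suc ⬝ n

/-- `¬ A` -/
def Not' (A : Ex) : Ex := A ⇒ C .empty
/-- `A ⊎ B` -/
def Sum' (i : ℕ) (A B : Ex) : Ex := C (.sum i) ⬝ A ⬝ B
/-- `Dec A`, that is `A ⊎ ¬ A` -/
def Dec (i : ℕ) (A : Ex) : Ex := Sum' i A (Not' A)
/-- `Σ (x : A). B x` -/
def Sig (i : ℕ) (A : Ex) (B : Ex → Ex) : Ex := C (.sigma i) ⬝ A ⬝ Lam A B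
/-- `A × B` -/
def Prod' (i : ℕ) (A B : Ex) : Ex := Sig i A fun _ => B
/-- The pair `(a, b) : Σ (x : A). B x` -/
def Pair (i : ℕ) (A : Ex) (B : Ex → Ex) (a b : Ex) : Ex := C (.pair i) ⬝ A ⬝ Lam A B ⬝ a ⬝ b
/-- First projection of `p : Σ (x : A). B x` -/
def Fst (i : ℕ) (A : Ex) (B : Ex → Ex) (p : Ex) : Ex :=
  C (.sigmaInd i i) ⬝ A ⬝ Lam A B ⬝ Lam (Sig i A B) (fun _ => A)
    ⬝ Lam A (fun a => Lam (B a) fun _ => a) ⬝ p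
/-- Second projection of `p : Σ (x : A). B x` -/
def Snd (i : ℕ) (A : Ex) (B : Ex → Ex) (p : Ex) : Ex :=
  C (.sigmaInd i i) ⬝ A ⬝ Lam A B ⬝ Lam (Sig i A B) (fun q => B (Fst i A B q))
    ⬝ Lam A (fun a => Lam (B a) fun b => b) ⬝ p
/-- The identity type `a =_A b` -/
def Eq' (i : ℕ) (A a b : Ex) : Ex := C (.id i) ⬝ A ⬝ a ⬝ b
/-- `refl_a : a = a` -/
def Refl (i : ℕ) (A a : Ex) : Ex := C (.refl i) ⬝ A ⬝ a
/-- `∃ (x : A). B x`, the propositional truncation of `Σ (x : A). B x` -/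
def Exist (i : ℕ) (A : Ex) (B : Ex → Ex) : Ex := C (.trunc i) ⬝ Sig i A B
/-- `isProp A` -/
def IsProp (i : ℕ) (A : Ex) : Ex := Pi A fun x => Pi A fun y => Eq' i A x y
/-- `isSet A` -/
def IsSet (i : ℕ) (A : Ex) : Ex := Pi A fun x => Pi A fun y => IsProp i (Eq' i A x y)
/-- Transport of `u : P a` along `p : a = b` in `A`, for a family `P : A → U_j` -/
def Transport (i j : ℕ) (A P a b p u : Ex) : Ex :=
  C (.idInd i j) ⬝ A ⬝ a ⬝ Lam A (fun y => Lam (Eq' i A a y) fun _ => P ⬝ a ⇒ P ⬝ y)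
    ⬝ Lam (P ⬝ a) (fun v => v) ⬝ b ⬝ p ⬝ u
/-- `A ↔ B`: functions in both directions -/
def Iff' (i : ℕ) (A B : Ex) : Ex := Prod' i (A ⇒ B) (B ⇒ A)

/-- The type of right inverses of `f : A → B` -/
def RInv (i : ℕ) (A B f : Ex) : Ex :=
  Sig i (B ⇒ A) fun g => Pi B fun y => Eq' i B (f ⬝ (g ⬝ y)) y
/-- The type of left inverses of `f : A → B` -/
def LInv (i : ℕ) (A B f : Ex) : Ex :=
  Sig i (B ⇒ A) fun g => Pi A fun x => Eq' i A (g ⬝ (f ⬝ x)) x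
/-- `f : A → B` is an equivalence (it has a right inverse and a left inverse). -/
def IsEquiv (i : ℕ) (A B f : Ex) : Ex := Prod' i (RInv i A B f) (LInv i A B f)
/-- `A ≃ B` -/
def Equiv' (i : ℕ) (A B : Ex) : Ex := Sig i (A ⇒ B) fun f => IsEquiv i A B f
/-- The identity equivalence of `A` -/
def IdEquiv (i : ℕ) (A : Ex) : Ex :=
  let one : Ex := Lam A fun x => x
  let inv : Ex := Pair i (A ⇒ A) (fun g => Pi A fun x => Eq' i A (g ⬝ x) x) one
    (Lam A fun x => Refl i A x)
  Pair i (A ⇒ A) (fun f => IsEquiv i A A f) one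
    (Pair i (RInv i A A one) (fun _ => LInv i A A one) inv inv)
/-- The canonical map `(A = B) → (A ≃ B)` for `A B : U_i` -/
def IdToEquiv (i : ℕ) (A B : Ex) : Ex :=
  Lam (Eq' (i + 1) (U i) A B) fun p =>
    C (.idInd (i + 1) i) ⬝ U i ⬝ A
      ⬝ Lam (U i) (fun X => Lam (Eq' (i + 1) (U i) A X) fun _ => Equiv' i A X)
      ⬝ IdEquiv i A ⬝ B ⬝ p

/-! ### Brouwer trees: auxiliary notions -/

def Brw : Ex := C .brw
/-- `x ≤ y` -/
def Leq (x y : Ex) : Ex := C .leq ⬝ x ⬝ y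
/-- `x < y`, that is `succ x ≤ y` -/
def Lt (x y : Ex) : Ex := Leq (C .bsucc ⬝ x) y
/-- The sequence `f : ℕ → Brw` is increasing: `f k < f (k + 1)` for all `k` -/
def IsIncr (f : Ex) : Ex := Pi Nat' fun k => Lt (f ⬝ k) (f ⬝ S k)
/-- The type of increasing sequences of Brouwer trees -/
def Incr : Ex := Sig 0 (Nat' ⇒ Brw) IsIncr
/-- The underlying sequence of an increasing sequence -/
def Seq' (f : Ex) : Ex := Fst 0 (Nat' ⇒ Brw) IsIncr f
/-- The `k`-th term of an increasing sequence -/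
def nth (f k : Ex) : Ex := Seq' f ⬝ k
/-- The proof that an increasing sequence increases at `k` -/
def incrAt (f k : Ex) : Ex := Snd 0 (Nat' ⇒ Brw) IsIncr f ⬝ k
/-- `f` is simulated by `g`: for all `k` there exists `n` with `f k ≤ g n` -/
def Sim (f g : Ex) : Ex := Pi Nat' fun k => Exist 0 Nat' fun n => Leq (nth f k) (nth g n)
/-- `f` and `g` are bisimilar -/
def Bisim (f g : Ex) : Ex := Prod' 0 (Sim f g) (Sim g f)

/-- The arguments of the induction principle of Brouwer trees: a family `B` of sets over `Brw`, a
family `L` of propositions over `≤` (and over the elements of `B` that lie over its two sides), and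
a method for each constructor. The inductive premises of `bisim` are truncated, as
the simulations are. -/
def IndTele (i j : ℕ) (K : (B L hB hL mz ms ml mb lz lt ls lc ll : Ex) → Ex) : Ex :=
  Pi (Brw ⇒ U i) fun B =>
  Pi (Pi Brw fun x => Pi Brw fun y => B ⬝ x ⇒ B ⬝ y ⇒ Leq x y ⇒ U j) fun L =>
  -- `B` is valued in sets and `L` in propositions
  Pi (Pi Brw fun x => IsSet i (B ⬝ x)) fun hB =>
  Pi (Pi Brw fun x => Pi Brw fun y => Pi (B ⬝ x) fun u => Pi (B ⬝ y) fun v =>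
    Pi (Leq x y) fun p => IsProp j (L ⬝ x ⬝ y ⬝ u ⬝ v ⬝ p)) fun hL =>
  -- `zero`
  Pi (B ⬝ C .bzero) fun mz =>
  -- `succ`
  Pi (Pi Brw fun x => B ⬝ x ⇒ B ⬝ (C .bsucc ⬝ x)) fun ms =>
  let Over (f : Ex) : Ex := Pi Nat' fun n => B ⬝ nth f n
  let IncrOver (f u : Ex) : Ex := Pi Nat' fun n =>
    L ⬝ (C .bsucc ⬝ nth f n) ⬝ nth f (S n) ⬝ (ms ⬝ nth f n ⬝ (u ⬝ n)) ⬝ (u ⬝ S n) ⬝ incrAt f n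
  let SimOver (f u g v : Ex) : Ex := Pi Nat' fun k => Exist j Nat' fun n =>
    Sig j (Leq (nth f k) (nth g n)) fun p => L ⬝ nth f k ⬝ nth g n ⬝ (u ⬝ k) ⬝ (v ⬝ n) ⬝ p
  -- `limit`
  Pi (Pi Incr fun f => Pi (Over f) fun u => IncrOver f u ⇒ B ⬝ (C .blimit ⬝ f)) fun ml =>
  -- `bisim`
  Pi (Pi Incr fun f => Pi (Over f) fun u => Pi (IncrOver f u) fun u' =>
    Pi Incr fun g => Pi (Over g) fun v => Pi (IncrOver g v) fun v' =>
    Pi (Bisim f g) fun s => SimOver f u g v ⇒ SimOver g v f u ⇒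
      Eq' i (B ⬝ (C .blimit ⬝ g))
        (Transport 0 i Brw B (C .blimit ⬝ f) (C .blimit ⬝ g) (C .bisim ⬝ f ⬝ g ⬝ s)
          (ml ⬝ f ⬝ u ⬝ u'))
        (ml ⬝ g ⬝ v ⬝ v')) fun mb =>
  -- `≤-zero`
  Pi (Pi Brw fun x => Pi (B ⬝ x) fun u => L ⬝ C .bzero ⬝ x ⬝ mz ⬝ u ⬝ (C .leqZero ⬝ x)) fun lz =>
  -- `≤-trans`
  Pi (Pi Brw fun x => Pi Brw fun y => Pi Brw fun z =>
    Pi (B ⬝ x) fun u => Pi (B ⬝ y) fun v => Pi (B ⬝ z) fun w =>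
    Pi (Leq x y) fun p => Pi (Leq y z) fun q =>
      L ⬝ x ⬝ y ⬝ u ⬝ v ⬝ p ⇒ L ⬝ y ⬝ z ⬝ v ⬝ w ⬝ q ⇒
        L ⬝ x ⬝ z ⬝ u ⬝ w ⬝ (C .leqTrans ⬝ x ⬝ y ⬝ z ⬝ p ⬝ q)) fun lt =>
  -- `≤-succ-mono`
  Pi (Pi Brw fun x => Pi Brw fun y => Pi (B ⬝ x) fun u => Pi (B ⬝ y) fun v =>
    Pi (Leq x y) fun p => L ⬝ x ⬝ y ⬝ u ⬝ v ⬝ p ⇒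
      L ⬝ (C .bsucc ⬝ x) ⬝ (C .bsucc ⬝ y) ⬝ (ms ⬝ x ⬝ u) ⬝ (ms ⬝ y ⬝ v)
        ⬝ (C .leqSuccMono ⬝ x ⬝ y ⬝ p)) fun ls =>
  -- `≤-cocone`
  Pi (Pi Incr fun f => Pi (Over f) fun u => Pi (IncrOver f u) fun u' =>
    Pi Brw fun x => Pi (B ⬝ x) fun v => Pi Nat' fun k => Pi (Leq x (nth f k)) fun p =>
      L ⬝ x ⬝ nth f k ⬝ v ⬝ (u ⬝ k) ⬝ p ⇒
        L ⬝ x ⬝ (C .blimit ⬝ f) ⬝ v ⬝ (ml ⬝ f ⬝ u ⬝ u') ⬝ (C .leqCocone ⬝ f ⬝ x ⬝ k ⬝ p)) fun lc =>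
  -- `≤-limiting`
  Pi (Pi Incr fun f => Pi (Over f) fun u => Pi (IncrOver f u) fun u' =>
    Pi Brw fun x => Pi (B ⬝ x) fun v => Pi (Pi Nat' fun k => Leq (nth f k) x) fun h =>
      (Pi Nat' fun k => L ⬝ nth f k ⬝ x ⬝ (u ⬝ k) ⬝ v ⬝ (h ⬝ k)) ⇒
        L ⬝ (C .blimit ⬝ f) ⬝ x ⬝ (ml ⬝ f ⬝ u ⬝ u') ⬝ v ⬝ (C .leqLimiting ⬝ f ⬝ x ⬝ h)) fun ll =>
  K B L hB hL mz ms ml mb lz lt ls lc ll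

/-- Application of `brwInd` or `leqInd` to the arguments listed in `IndTele`. -/
def indAp (c : Const) (B L hB hL mz ms ml mb lz lt ls lc ll : Ex) : Ex :=
  C c ⬝ B ⬝ L ⬝ hB ⬝ hL ⬝ mz ⬝ ms ⬝ ml ⬝ mb ⬝ lz ⬝ lt ⬝ ls ⬝ lc ⬝ ll

/-! ### The types of the constants -/

/-- The type of each constant. -/
def Const.typeEx : Const → Ex
  | empty => U 0
  | emptyInd j => Pi (C empty ⇒ U j) fun P => Pi (C empty) fun x => P ⬝ x
  | unit => U 0
  | star => C unit
  | unitInd j => Pi (C unit ⇒ U j) fun P => P ⬝ C star ⇒ Pi (C unit) fun x => P ⬝ x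
  | two => U 0
  | ff => C two
  | tt => C two
  | twoInd j => Pi (C two ⇒ U j) fun P => P ⬝ C ff ⇒ P ⬝ C tt ⇒ Pi (C two) fun x => P ⬝ x
  | nat => U 0
  | zero => C nat
  | suc => C nat ⇒ C nat
  | natInd j => Pi (C nat ⇒ U j) fun P =>
      P ⬝ C zero ⇒ (Pi (C nat) fun n => P ⬝ n ⇒ P ⬝ S n) ⇒ Pi (C nat) fun n => P ⬝ n
  | sum i => U i ⇒ U i ⇒ U i
  | inl i => Pi (U i) fun A => Pi (U i) fun B => A ⇒ Sum' i A B
  | inr i => Pi (U i) fun A => Pi (U i) fun B => B ⇒ Sum' i A B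
  | sumInd i j => Pi (U i) fun A => Pi (U i) fun B => Pi (Sum' i A B ⇒ U j) fun P =>
      (Pi A fun a => P ⬝ (C (inl i) ⬝ A ⬝ B ⬝ a)) ⇒
      (Pi B fun b => P ⬝ (C (inr i) ⬝ A ⬝ B ⬝ b)) ⇒
      Pi (Sum' i A B) fun x => P ⬝ x
  | sigma i => Pi (U i) fun A => (A ⇒ U i) ⇒ U i
  | pair i => Pi (U i) fun A => Pi (A ⇒ U i) fun B =>
      Pi A fun a => B ⬝ a ⇒ C (sigma i) ⬝ A ⬝ B
  | sigmaInd i j => Pi (U i) fun A => Pi (A ⇒ U i) fun B =>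
      Pi (C (sigma i) ⬝ A ⬝ B ⇒ U j) fun P =>
      (Pi A fun a => Pi (B ⬝ a) fun b => P ⬝ (C (pair i) ⬝ A ⬝ B ⬝ a ⬝ b)) ⇒
      Pi (C (sigma i) ⬝ A ⬝ B) fun x => P ⬝ x
  | id i => Pi (U i) fun A => A ⇒ A ⇒ U i
  | refl i => Pi (U i) fun A => Pi A fun a => Eq' i A a a
  | idInd i j => Pi (U i) fun A => Pi A fun a => Pi (Pi A fun y => Eq' i A a y ⇒ U j) fun P =>
      P ⬝ a ⬝ Refl i A a ⇒ Pi A fun y => Pi (Eq' i A a y) fun p => P ⬝ y ⬝ p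
  | trunc i => U i ⇒ U i
  | tr i => Pi (U i) fun A => A ⇒ C (trunc i) ⬝ A
  | trEq i => Pi (U i) fun A => IsProp i (C (trunc i) ⬝ A)
  | truncInd i j => Pi (U i) fun A => Pi (C (trunc i) ⬝ A ⇒ U j) fun P =>
      (Pi (C (trunc i) ⬝ A) fun x => IsProp j (P ⬝ x)) ⇒
      (Pi A fun a => P ⬝ (C (tr i) ⬝ A ⬝ a)) ⇒
      Pi (C (trunc i) ⬝ A) fun x => P ⬝ x
  | funext i => Pi (U i) fun A => Pi (A ⇒ U i) fun B =>
      Pi (Pi A fun x => B ⬝ x) fun f => Pi (Pi A fun x => B ⬝ x) fun g =>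
      (Pi A fun x => Eq' i (B ⬝ x) (f ⬝ x) (g ⬝ x)) ⇒ Eq' i (Pi A fun x => B ⬝ x) f g
  | univalence i => Pi (U i) fun A => Pi (U i) fun B =>
      IsEquiv (i + 1) (Eq' (i + 1) (U i) A B) (Equiv' i A B) (IdToEquiv i A B)
  | brw => U 0
  | bzero => Brw
  | bsucc => Brw ⇒ Brw
  | blimit => Incr ⇒ Brw
  | bisim => Pi Incr fun f => Pi Incr fun g =>
      Bisim f g ⇒ Eq' 0 Brw (C blimit ⬝ f) (C blimit ⬝ g)
  | brwSet => IsSet 0 Brw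
  | leq => Brw ⇒ Brw ⇒ U 0
  | leqZero => Pi Brw fun x => Leq (C bzero) x
  | leqTrans => Pi Brw fun x => Pi Brw fun y => Pi Brw fun z => Leq x y ⇒ Leq y z ⇒ Leq x z
  | leqSuccMono => Pi Brw fun x => Pi Brw fun y =>
      Leq x y ⇒ Leq (C bsucc ⬝ x) (C bsucc ⬝ y)
  | leqCocone => Pi Incr fun f => Pi Brw fun x => Pi Nat' fun k =>
      Leq x (nth f k) ⇒ Leq x (C blimit ⬝ f)
  | leqLimiting => Pi Incr fun f => Pi Brw fun x =>
      (Pi Nat' fun k => Leq (nth f k) x) ⇒ Leq (C blimit ⬝ f) x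
  | leqProp => Pi Brw fun x => Pi Brw fun y => IsProp 0 (Leq x y)
  | brwInd i j => IndTele i j fun B _ _ _ _ _ _ _ _ _ _ _ _ => Pi Brw fun x => B ⬝ x
  | leqInd i j => IndTele i j fun B L hB hL mz ms ml mb lz lt ls lc ll =>
      let r := indAp (brwInd i j) B L hB hL mz ms ml mb lz lt ls lc ll
      Pi Brw fun x => Pi Brw fun y => Pi (Leq x y) fun p => L ⬝ x ⬝ y ⬝ (r ⬝ x) ⬝ (r ⬝ y) ⬝ p

/-- The type of each constant, as a closed raw term. -/
def Const.type (c : Const) : Tm := c.typeEx 0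

/-! ### Judgemental equality -/

/-- Application of raw terms. -/
infixl:70 " ⬝ₜ " => Tm.app

instance : Coe Const Tm := ⟨Tm.const⟩

/-- Application of `brwInd` or `leqInd` to the arguments listed in `IndTele`, as a raw term. -/
abbrev indApp (c : Const) (B L hB hL mz ms ml mb lz lt ls lc ll : Tm) : Tm :=
  Tm.const c ⬝ₜ B ⬝ₜ L ⬝ₜ hB ⬝ₜ hL ⬝ₜ mz ⬝ₜ ms ⬝ₜ ml ⬝ₜ mb ⬝ₜ lz ⬝ₜ lt ⬝ₜ ls ⬝ₜ lc ⬝ₜ ll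

/-- The right-hand side of the computation rule for `brwInd` at `limit f`: the method `ml`, applied
to `f`, to `λ n. brwInd (f n)`, and to `λ n. leqInd (succ (f n)) (f (n + 1)) p` where `p` proves
that `f` increases at `n`. -/
def limitRhs (i j : ℕ) (B L hB hL mz ms ml mb lz lt ls lc ll f : Tm) : Tm :=
  let ind (c : Const) : Ex := emb (indApp c B L hB hL mz ms ml mb lz lt ls lc ll)
  (emb ml ⬝ emb f ⬝ (Lam Nat' fun n => ind (.brwInd i j) ⬝ nth (emb f) n)
    ⬝ (Lam Nat' fun n => ind (.leqInd i j)
        ⬝ (C .bsucc ⬝ nth (emb f) n) ⬝ nth (emb f) (S n) ⬝ incrAt (emb f) n)) 0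

/-- The reduction rules, at the root of a term: `β` and `η` for functions, and one rule for each
induction principle and each point constructor. There are no rules for constructors of
equalities or of `≤`: the motives over these are families of sets and of propositions, so that
the equations in question hold propositionally. -/
inductive Step : Tm → Tm → Prop
  | beta (A b a : Tm) : Step (.lam A b ⬝ₜ a) (b.inst a)
  | eta (A f : Tm) : Step (.lam A (f.lift 1 ⬝ₜ .var 0)) f
  | star (j : ℕ) (P u : Tm) : Step (Const.unitInd j ⬝ₜ P ⬝ₜ u ⬝ₜ Const.star) u
  | ff (j : ℕ) (P u v : Tm) : Step (Const.twoInd j ⬝ₜ P ⬝ₜ u ⬝ₜ v ⬝ₜ Const.ff) u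
  | tt (j : ℕ) (P u v : Tm) : Step (Const.twoInd j ⬝ₜ P ⬝ₜ u ⬝ₜ v ⬝ₜ Const.tt) v
  | zero (j : ℕ) (P u v : Tm) : Step (Const.natInd j ⬝ₜ P ⬝ₜ u ⬝ₜ v ⬝ₜ Const.zero) u
  | suc (j : ℕ) (P u v n : Tm) : Step (Const.natInd j ⬝ₜ P ⬝ₜ u ⬝ₜ v ⬝ₜ (Const.suc ⬝ₜ n))
      (v ⬝ₜ n ⬝ₜ (Const.natInd j ⬝ₜ P ⬝ₜ u ⬝ₜ v ⬝ₜ n))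
  | inl (i j : ℕ) (A B P u v A' B' a : Tm) :
      Step (Const.sumInd i j ⬝ₜ A ⬝ₜ B ⬝ₜ P ⬝ₜ u ⬝ₜ v ⬝ₜ (Const.inl i ⬝ₜ A' ⬝ₜ B' ⬝ₜ a)) (u ⬝ₜ a)
  | inr (i j : ℕ) (A B P u v A' B' b : Tm) :
      Step (Const.sumInd i j ⬝ₜ A ⬝ₜ B ⬝ₜ P ⬝ₜ u ⬝ₜ v ⬝ₜ (Const.inr i ⬝ₜ A' ⬝ₜ B' ⬝ₜ b)) (v ⬝ₜ b)
  | pair (i j : ℕ) (A B P u A' B' a b : Tm) :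
      Step (Const.sigmaInd i j ⬝ₜ A ⬝ₜ B ⬝ₜ P ⬝ₜ u ⬝ₜ (Const.pair i ⬝ₜ A' ⬝ₜ B' ⬝ₜ a ⬝ₜ b)) (u ⬝ₜ a ⬝ₜ b)
  | refl (i j : ℕ) (A a P u b A' a' : Tm) :
      Step (Const.idInd i j ⬝ₜ A ⬝ₜ a ⬝ₜ P ⬝ₜ u ⬝ₜ b ⬝ₜ (Const.refl i ⬝ₜ A' ⬝ₜ a')) u
  | tr (i j : ℕ) (A P h u A' a : Tm) :
      Step (Const.truncInd i j ⬝ₜ A ⬝ₜ P ⬝ₜ h ⬝ₜ u ⬝ₜ (Const.tr i ⬝ₜ A' ⬝ₜ a)) (u ⬝ₜ a)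
  | bzero (i j : ℕ) (B L hB hL mz ms ml mb lz lt ls lc ll : Tm) :
      Step (indApp (.brwInd i j) B L hB hL mz ms ml mb lz lt ls lc ll ⬝ₜ Const.bzero) mz
  | bsucc (i j : ℕ) (B L hB hL mz ms ml mb lz lt ls lc ll x : Tm) :
      Step (indApp (.brwInd i j) B L hB hL mz ms ml mb lz lt ls lc ll ⬝ₜ (Const.bsucc ⬝ₜ x))
        (ms ⬝ₜ x ⬝ₜ (indApp (.brwInd i j) B L hB hL mz ms ml mb lz lt ls lc ll ⬝ₜ x))
  | blimit (i j : ℕ) (B L hB hL mz ms ml mb lz lt ls lc ll f : Tm) :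
      Step (indApp (.brwInd i j) B L hB hL mz ms ml mb lz lt ls lc ll ⬝ₜ (Const.blimit ⬝ₜ f))
        (limitRhs i j B L hB hL mz ms ml mb lz lt ls lc ll f)

/-- Judgemental equality: the congruence generated by the reduction rules. -/
inductive Conv : Tm → Tm → Prop
  | step {t u : Tm} : Step t u → Conv t u
  | refl (t : Tm) : Conv t t
  | symm {t u : Tm} : Conv t u → Conv u t
  | trans {t u v : Tm} : Conv t u → Conv u v → Conv t v
  | pi {A A' B B' : Tm} : Conv A A' → Conv B B' → Conv (.pi A B) (.pi A' B')
  | lam {A A' b b' : Tm} : Conv A A' → Conv b b' → Conv (.lam A b) (.lam A' b')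
  | app {f f' a a' : Tm} : Conv f f' → Conv a a' → Conv (.app f a) (.app f' a')

/-! ### Typing -/

/-- `HasType Γ t A`: in the context `Γ`, the term `t` has type `A`. The context lists the types of
the variables, the most recent one first. Every extension of a context by `pi` and
`lam` is by a type, so that all contexts in a derivation with an empty context are well formed. -/
inductive HasType : List Tm → Tm → Tm → Prop
  | var {Γ : List Tm} {n : ℕ} {A : Tm} : Γ[n]? = some A → HasType Γ (.var n) (A.lift (n + 1))
  | univ (Γ : List Tm) (i : ℕ) : HasType Γ (.univ i) (.univ (i + 1))
  | const (Γ : List Tm) (c : Const) : HasType Γ (.const c) c.type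
  | pi {Γ : List Tm} {A B : Tm} {i : ℕ} : HasType Γ A (.univ i) → HasType (A :: Γ) B (.univ i) →
      HasType Γ (.pi A B) (.univ i)
  | lam {Γ : List Tm} {A B b : Tm} {i : ℕ} : HasType Γ A (.univ i) → HasType (A :: Γ) b B →
      HasType Γ (.lam A b) (.pi A B)
  | app {Γ : List Tm} {A B f a : Tm} : HasType Γ f (.pi A B) → HasType Γ a A →
      HasType Γ (.app f a) (B.inst a)
  | conv {Γ : List Tm} {A B t : Tm} {i : ℕ} : HasType Γ t A → HasType Γ B (.univ i) →
      Conv A B → HasType Γ t B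
  | cumul {Γ : List Tm} {A : Tm} {i : ℕ} : HasType Γ A (.univ i) → HasType Γ A (.univ (i + 1))

/-- The closed type `A` holds: it has an element in the empty context. -/
def Holds (A : Ex) : Prop := ∃ t : Tm, HasType [] t (A 0)

/-! ### The weak limited principle of omniscience, and the Brouwer tree `ω` -/

/-- `WLPO`: for all `s : ℕ → 2`, either `s n = ff` for all `n`, or not. -/
def WLPO : Ex := Pi (Nat' ⇒ C .two) fun s =>
  let allff : Ex := Pi Nat' fun n => Eq' 0 (C .two) (s ⬝ n) (C .ff)
  Sum' 0 allff (Not' allff)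

/-- The embedding `ι : ℕ → Brw` of the natural numbers: `ι 0 = zero` and
`ι (n + 1) = succ (ι n)`. -/
def iota : Ex := C (.natInd 0) ⬝ (Lam Nat' fun _ => Brw) ⬝ C .bzero
  ⬝ (Lam Nat' fun _ => Lam Brw fun x => C .bsucc ⬝ x)

/-- `ι` is increasing. -/
def iotaIncr : Ex := C (.natInd 0) ⬝ (Lam Nat' fun k => Lt (iota ⬝ k) (iota ⬝ S k))
  ⬝ (C .leqSuccMono ⬝ C .bzero ⬝ C .bzero ⬝ (C .leqZero ⬝ C .bzero))
  ⬝ (Lam Nat' fun k => Lam (Lt (iota ⬝ k) (iota ⬝ S k)) fun h =>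
      C .leqSuccMono ⬝ (C .bsucc ⬝ (iota ⬝ k)) ⬝ (iota ⬝ S k) ⬝ h)

/-- `ω`, the limit of `ι` -/
def omega : Ex := C .blimit ⬝ Pair 0 (Nat' ⇒ Brw) IsIncr iota iotaIncr

/-- `Brw` has locally decidable equality at `ω`. -/
def DecEqOmega : Ex := Pi Brw fun x => Dec 0 (Eq' 0 Brw x omega)

end HoTT

/-! `Holds` is derivability in a formal system, so a proof is a raw term together with a typing
derivation. The terms are written out explicitly, and a type checker, proved sound in `infer_sound`
and evaluated by the kernel, supplies the derivations. Neither confluence nor normalization nor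
subject reduction is needed: the checker may fail, but whatever it accepts must be derivable. The
lemmas of type theory form a list in which a proof term may use earlier statements as variables;
substituting their proofs (`Realizes.cons`) leaves a closed term.

The mathematics inside the theory is as follows. Each tree is, decidably, either below some `ι n` or
above `ω` (`finOrInf`), because limits always lie above `ω`. Since `ω < ω` is absurd
(`omegaIrrefl`), neither `zero` nor a successor equals `ω`. A limit of `f` equals `ω` exactly when
all `f k` are finite: if they are, then `f` is bisimilar to `ι`; and `ω ≤ f k` would give `ω < f (k
+ 1) ≤ limit f`. Finiteness of the `f k` is recorded by a binary sequence, so `WLPO` decides the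
question. Conversely, a binary sequence `s` yields the increasing sequence `jump s`, which counts
`0, 1, 2, …` but passes beyond `ω` once `s` takes the value `tt`; its limit is `ω` exactly when `s`
is constantly `ff`.

The substantial ingredient is the inversion of `a < x` at each constructor (`invertLtTm`). It comes
from defining `a < x` anew by recursion on `x`, with values in the type of propositions, which is a
set by univalence. The component of the induction principle that concerns `≤` shows that this
predicate is monotone. -/

namespace HoTT

open Tm

/-! ### Renaming and substitution -/

namespace Tm

theorem up_var : up var = var := by
  funext n; cases n <;> rfl

theorem subst_var (t : Tm) : subst var t = t := by
  induction t <;> simp_all [subst, up_var]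

theorem up_comp_ren (r : ℕ → ℕ) : (fun n => var (upRen r n)) = up fun n => var (r n) := by
  funext n; cases n <;> rfl

theorem rename_eq_subst (r : ℕ → ℕ) (t : Tm) : rename r t = subst (fun n => var (r n)) t := by
  induction t generalizing r <;> simp_all [subst, rename, ← up_comp_ren]

theorem subst_rename (s : ℕ → Tm) (r : ℕ → ℕ) (t : Tm) :
    subst s (rename r t) = subst (fun n => s (r n)) t := by
  have h (s : ℕ → Tm) (r : ℕ → ℕ) : (fun n => up s (upRen r n)) = up fun n => s (r n) := by
    funext n; cases n <;> rfl
  induction t generalizing r s <;> simp_all [subst, rename]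

theorem rename_rename (r r' : ℕ → ℕ) (t : Tm) :
    rename r (rename r' t) = rename (fun n => r (r' n)) t := by
  rw [rename_eq_subst r, subst_rename, rename_eq_subst]

theorem rename_subst (r : ℕ → ℕ) (s : ℕ → Tm) (t : Tm) :
    rename r (subst s t) = subst (fun n => rename r (s n)) t := by
  have h (s : ℕ → Tm) (r : ℕ → ℕ) : (fun n => rename (upRen r) (up s n)) =
      up fun n => rename r (s n) := by
    funext n
    cases n
    · rfl
    · simp [up, lift, rename_rename, upRen]
  induction t generalizing r s <;> simp_all [subst, rename]

theorem subst_subst (s s' : ℕ → Tm) (t : Tm) :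
    subst s (subst s' t) = subst (fun n => subst s (s' n)) t := by
  have h (s s' : ℕ → Tm) : (fun n => subst (up s) (up s' n)) = up fun n => subst s (s' n) := by
    funext n
    cases n
    · rfl
    · simp [up, lift, rename_subst, subst_rename]
  induction t generalizing s s' <;> simp_all [subst]

theorem subst_lift_one (s : ℕ → Tm) (t : Tm) : subst (up s) (lift 1 t) = lift 1 (subst s t) := by
  simp [lift, subst_rename, rename_subst, up]

theorem inst_lift_one (t a : Tm) : (lift 1 t).inst a = t := by
  rw [inst, lift, subst_rename]
  exact subst_var t

theorem lift_lift (k l : ℕ) (t : Tm) : lift k (lift l t) = lift (l + k) t := by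
  simp [lift, rename_rename, Nat.add_assoc]

theorem subst_inst (s : ℕ → Tm) (b a : Tm) :
    subst s (b.inst a) = (subst (up s) b).inst (subst s a) := by
  rw [inst, inst, subst_subst, subst_subst]
  congr 1
  funext n
  cases n with
  | zero => rfl
  | succ n => exact (inst_lift_one _ _).symm

end Tm


/-! ### Judgemental equality is stable under substitution -/

theorem subst_limitRhs (s : ℕ → Tm) (i j : ℕ) (B L hB hL mz ms ml mb lz lt ls lc ll f : Tm) :
    subst s (limitRhs i j B L hB hL mz ms ml mb lz lt ls lc ll f) =
      limitRhs i j (subst s B) (subst s L) (subst s hB) (subst s hL) (subst s mz) (subst s ms)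
        (subst s ml) (subst s mb) (subst s lz) (subst s lt) (subst s ls) (subst s lc) (subst s ll)
        (subst s f) := by
  simp [limitRhs, Ap, Lam, emb, subst, nth, Seq', Fst, incrAt, Snd, Nat', S, C, bvar, Sig, IsIncr,
    Pi, Lt, Leq, Arr, Brw, up, subst_lift_one]
  simp [lift, rename]

theorem Step.subst (s : ℕ → Tm) {t u : Tm} (h : Step t u) : Step (t.subst s) (u.subst s) := by
  cases h with
  | beta => rw [subst_inst]; exact .beta ..
  | eta =>
    simp only [Tm.subst, subst_lift_one]
    exact .eta ..
  | blimit => rw [subst_limitRhs]; exact .blimit ..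
  | _ => constructor

theorem Conv.subst (s : ℕ → Tm) {t u : Tm} (h : Conv t u) : Conv (t.subst s) (u.subst s) := by
  induction h generalizing s with
  | step h => exact .step (h.subst s)
  | refl => exact .refl _
  | symm _ ih => exact (ih s).symm
  | trans _ _ ih ih' => exact (ih s).trans (ih' s)
  | pi _ _ ih ih' => exact .pi (ih s) (ih' _)
  | lam _ _ ih ih' => exact .lam (ih s) (ih' _)
  | app _ _ ih ih' => exact .app (ih s) (ih' s)

/-- All variables of the term are smaller than `k`. -/
def Tm.closedAt : ℕ → Tm → Bool
  | k, var n => n.blt k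
  | _, univ _ => true
  | k, pi A B => closedAt k A && closedAt (k + 1) B
  | k, lam A b => closedAt k A && closedAt (k + 1) b
  | k, app f a => closedAt k f && closedAt k a
  | _, const _ => true

theorem Tm.subst_of_closedAt {k : ℕ} {t : Tm} (h : t.closedAt k = true) {s : ℕ → Tm}
    (hs : ∀ n < k, s n = var n) : t.subst s = t := by
  have hup {k : ℕ} {s : ℕ → Tm} (hs : ∀ n < k, s n = var n) : ∀ n < k + 1, up s n = var n := by
    intro n hn
    cases n with
    | zero => rfl
    | succ n => simp [up, hs n (by omega), lift, rename]
  induction t generalizing k s with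
  | var n => exact hs n (by simpa [closedAt] using h)
  | univ | const => rfl
  | pi A B ihA ihB | lam A B ihA ihB =>
    simp only [closedAt, Bool.and_eq_true] at h
    rw [Tm.subst, ihA h.1 hs, ihB h.2 (hup hs)]
  | app f a ihf iha =>
    simp only [closedAt, Bool.and_eq_true] at h
    rw [Tm.subst, ihf h.1 hs, iha h.2 hs]

/-- Universe levels do not affect which variables occur, so evaluation succeeds even with the levels
of the constant left symbolic. Closedness is what lets the typing rule for constants survive
renaming and substitution. -/
theorem Const.closedAt_type (c : Const) : c.type.closedAt 0 = true := by
  cases c <;> rfl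

theorem Const.subst_type (c : Const) (s : ℕ → Tm) : c.type.subst s = c.type :=
  Tm.subst_of_closedAt c.closedAt_type (by simp)

theorem Conv.lift (k : ℕ) {t u : Tm} (h : Conv t u) : Conv (t.lift k) (u.lift k) := by
  simpa only [Tm.lift, rename_eq_subst] using h.subst _

/-! ### Typing is stable under renaming and substitution -/

namespace HasType

/-- Renamings act on typing derivations. -/
theorem rename {Γ Δ : List Tm} {t A : Tm} (h : HasType Γ t A) {r : ℕ → ℕ}
    (hr : ∀ n A, Γ[n]? = some A →
      ∃ A', Δ[r n]? = some A' ∧ A'.lift (r n + 1) = (A.lift (n + 1)).rename r) :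
    HasType Δ (t.rename r) (A.rename r) := by
  have hup {Γ Δ : List Tm} {r : ℕ → ℕ} (hr : ∀ n A, Γ[n]? = some A →
      ∃ A', Δ[r n]? = some A' ∧ A'.lift (r n + 1) = (A.lift (n + 1)).rename r) (C : Tm) :
      ∀ n A, (C :: Γ)[n]? = some A → ∃ A', (C.rename r :: Δ)[upRen r n]? = some A' ∧
        A'.lift (upRen r n + 1) = (A.lift (n + 1)).rename (upRen r) := by
    intro n A h
    cases n with
    | zero =>
      obtain rfl : C = A := by simpa using h
      exact ⟨_, rfl, by simp [Tm.lift, rename_rename, upRen]⟩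
    | succ n =>
      obtain ⟨A', h₁, h₂⟩ := hr n A (by simpa using h)
      refine ⟨A', by simpa [upRen] using h₁, ?_⟩
      have := congrArg (Tm.lift 1) h₂
      simp only [Tm.lift, rename_rename] at this ⊢
      simpa [upRen, Nat.add_assoc] using this
  induction h generalizing Δ r with
  | @var Γ n A h =>
    obtain ⟨A', h₁, h₂⟩ := hr n A h
    exact h₂ ▸ .var h₁
  | univ => exact .univ ..
  | const Γ c =>
    rw [rename_eq_subst r c.type, Const.subst_type]
    exact .const ..
  | pi _ _ ih ih' => exact .pi (ih hr) (ih' (hup hr _))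
  | lam _ _ ih ih' => exact .lam (ih hr) (ih' (hup hr _))
  | @app Γ A B f a _ _ ih ih' =>
    have e : (B.inst a).rename r = (B.rename (upRen r)).inst (a.rename r) := by
      simp only [rename_eq_subst, subst_inst, ← up_comp_ren]
    exact e ▸ .app (ih hr) (ih' hr)
  | conv _ _ hc ih ih' =>
    exact .conv (ih hr) (ih' hr) (by simpa only [rename_eq_subst] using hc.subst _)
  | cumul _ ih => exact .cumul (ih hr)

theorem lift_one {Γ : List Tm} {t A : Tm} (h : HasType Γ t A) (C : Tm) :
    HasType (C :: Γ) (t.lift 1) (A.lift 1) :=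
  h.rename fun n A h => ⟨A, by simpa using h, by simp [Tm.lift, rename_rename, Nat.add_assoc]⟩

/-- Substitutions act on typing derivations. -/
theorem subst {Γ Δ : List Tm} {t A : Tm} (h : HasType Γ t A) {s : ℕ → Tm}
    (hs : ∀ n A, Γ[n]? = some A → HasType Δ (s n) ((A.lift (n + 1)).subst s)) :
    HasType Δ (t.subst s) (A.subst s) := by
  have hup {Γ Δ : List Tm} {s : ℕ → Tm}
      (hs : ∀ n A, Γ[n]? = some A → HasType Δ (s n) ((A.lift (n + 1)).subst s)) (C : Tm) :
      ∀ n A, (C :: Γ)[n]? = some A →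
        HasType (C.subst s :: Δ) (up s n) ((A.lift (n + 1)).subst (up s)) := by
    intro n A h
    cases n with
    | zero =>
      obtain rfl : C = A := by simpa using h
      rw [subst_lift_one]
      exact .var rfl
    -- Going under a binder weakens the substituted terms, which is why renaming has to be treated
    -- before substitution.
    | succ n =>
      rw [← lift_lift 1, subst_lift_one]
      exact (hs n A (by simpa using h)).lift_one _
  induction h generalizing Δ s with
  | var h => exact hs _ _ h
  | univ => exact .univ ..
  | const Γ c =>
    rw [Const.subst_type]
    exact .const ..
  | pi _ _ ih ih' => exact .pi (ih hs) (ih' (hup hs _))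
  | lam _ _ ih ih' => exact .lam (ih hs) (ih' (hup hs _))
  | app _ _ ih ih' =>
    rw [subst_inst]
    exact .app (ih hs) (ih' hs)
  | conv _ _ hc ih ih' => exact .conv (ih hs) (ih' hs) (hc.subst _)
  | cumul _ ih => exact .cumul (ih hs)

theorem inst {Γ : List Tm} {C b B a : Tm} (h : HasType (C :: Γ) b B) (ha : HasType Γ a C) :
    HasType Γ (b.inst a) (B.inst a) := by
  refine h.subst fun n A h => ?_
  cases n with
  | zero =>
    obtain rfl : C = A := by simpa using h
    change HasType Γ a ((C.lift 1).inst a)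
    rwa [inst_lift_one]
  | succ n =>
    have e : (A.lift (n + 1 + 1)).subst (single a) = A.lift (n + 1) := by
      rw [← lift_lift 1]
      exact inst_lift_one _ _
    exact e ▸ .var (by simpa using h)

/-- Types that are dependent products have a domain and a codomain in some universe. -/
theorem pi_inv {Γ : List Tm} {A B T : Tm} (h : HasType Γ (.pi A B) T) :
    ∃ i, HasType Γ A (.univ i) ∧ HasType (A :: Γ) B (.univ i) := by
  generalize ht : Tm.pi A B = t at h
  induction h with
  | pi h h' => cases ht; exact ⟨_, h, h'⟩
  | conv _ _ _ ih | cumul _ ih => exact ih ht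
  | _ => cases ht

theorem cumul_le {Γ : List Tm} {A : Tm} {i j : ℕ} (h : HasType Γ A (.univ i)) (hij : i ≤ j) :
    HasType Γ A (.univ j) := by
  induction hij with
  | refl => exact h
  | step _ ih => exact .cumul ih

end HasType

namespace Tm

/-! ### A type checker

The checker is evaluated by the kernel; `shift` and `instAt` are given by the recursor because
they are evaluated most often. -/

/-- Weakening by `k` variables under `c` binders. -/
noncomputable def shift (k c : ℕ) (t : Tm) : Tm :=
  Tm.rec (motive := fun _ => ℕ → Tm) (fun n c => var (bif n.blt c then n else n + k))
    (fun i _ => univ i) (fun _ _ A B c => pi (A c) (B (c + 1)))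
    (fun _ _ A b c => lam (A c) (b (c + 1))) (fun _ _ f a c => app (f c) (a c))
    (fun e _ => const e) t c

/-- Substitution of `a` for the variable `0` under `c` binders. -/
noncomputable def instAt (a : Tm) (c : ℕ) (t : Tm) : Tm :=
  Tm.rec (motive := fun _ => ℕ → Tm)
    (fun n c => bif n.blt c then var n else bif n.beq c then shift c 0 a else var n.pred)
    (fun i _ => univ i) (fun _ _ A B c => pi (A c) (B (c + 1)))
    (fun _ _ A b c => lam (A c) (b (c + 1))) (fun _ _ f b c => app (f c) (b c))
    (fun e _ => const e) t c

/-- Boolean equality of terms. -/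
def beq : Tm → Tm → Bool
  | var n, var m => n.beq m
  | univ i, univ j => i.beq j
  | pi A B, pi A' B' => beq A A' && beq B B'
  | lam A b, lam A' b' => beq A A' && beq b b'
  | app f a, app f' a' => beq f f' && beq a a'
  | const c, const c' => decide (c = c')
  | _, _ => false

/-- Only this direction is ever used: the checker has to be sound, not complete. -/
theorem eq_of_beq {t u : Tm} (h : t.beq u = true) : t = u := by
  induction t generalizing u <;> cases u <;> simp_all [beq]
  all_goals grind

theorem shift_eq_rename (k c : ℕ) (t : Tm) :
    t.shift k c = t.rename fun n => if n < c then n else n + k := by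
  have h (c : ℕ) : (upRen fun n => if n < c then n else n + k) =
      fun n => if n < c + 1 then n else n + k := by
    funext n
    cases n with
    | zero => simp [upRen]
    | succ n => simp only [upRen]; split_ifs <;> omega
  induction t generalizing c with
  | var n => by_cases hn : n < c <;> simp [shift, rename, Nat.blt_eq, hn, cond_eq_ite]
  | _ => simp_all [shift, rename]

theorem shift_zero_eq_lift (k : ℕ) (t : Tm) : t.shift k 0 = t.lift k := by
  simp [shift_eq_rename, lift]

theorem instAt_eq_subst (a : Tm) (c : ℕ) (t : Tm) : instAt a c t =
    t.subst fun n => if n < c then var n else if n = c then a.lift c else var n.pred := by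
  have h (c : ℕ) : (up fun n => if n < c then var n else if n = c then a.lift c else var n.pred) =
      fun n => if n < c + 1 then var n else if n = c + 1 then a.lift (c + 1) else var n.pred := by
    funext n
    cases n with
    | zero => simp [up]
    | succ n =>
      simp only [up, Nat.add_lt_add_iff_right, Nat.add_right_cancel_iff, Nat.pred_succ]
      split_ifs with h₁ h₂
      · rfl
      · rw [lift_lift]
      · obtain ⟨m, rfl⟩ : ∃ m, n = m + 1 := ⟨n - 1, by omega⟩
        rfl
  induction t generalizing c with
  | var n =>
    by_cases hn : n < c <;> by_cases hc : n = c <;>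
      simp [instAt, subst, Nat.blt_eq, hn, hc, cond_eq_ite, shift_zero_eq_lift]
  | _ => simp_all [instAt, subst]

theorem instAt_zero_eq_inst (a t : Tm) : instAt a 0 t = t.inst a := by
  rw [instAt_eq_subst, inst]
  congr 1
  funext n
  cases n with
  | zero => simp [single, lift, rename_eq_subst, subst_var]
  | succ n => simp [single]

/-- The application of a term to a list of arguments. -/
def apps : Tm → List Tm → Tm
  | t, [] => t
  | t, a :: as => apps (app t a) as

end Tm

theorem Conv.apps {t u : Tm} (h : Conv t u) (as : List Tm) : Conv (t.apps as) (u.apps as) := by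
  induction as generalizing t u with
  | nil => exact h
  | cons a as ih => exact ih (h.app (.refl a))

/-- One reduction step for an induction principle applied to a list of arguments, `wh` being used
to evaluate the last argument. -/
def iotaStep (wh : Tm → Tm × List Tm) (c : Const) (as : List Tm) : Option (Tm × List Tm) :=
  match c with
  | .unitInd _ => match as with
    | _ :: u :: x :: as => match wh x with
      | (.const .star, []) => some (u, as)
      | _ => none
    | _ => none
  | .twoInd _ => match as with
    | _ :: u :: v :: x :: as => match wh x with
      | (.const .ff, []) => some (u, as)
      | (.const .tt, []) => some (v, as)
      | _ => none
    | _ => none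
  | .natInd j => match as with
    | P :: u :: v :: x :: as => match wh x with
      | (.const .zero, []) => some (u, as)
      | (.const .suc, [n]) => some (v, n :: (Const.natInd j ⬝ₜ P ⬝ₜ u ⬝ₜ v ⬝ₜ n) :: as)
      | _ => none
    | _ => none
  | .sumInd i _ => match as with
    | _ :: _ :: _ :: u :: v :: x :: as => match wh x with
      | (.const (.inl i'), [_, _, a]) => bif i'.beq i then some (u, a :: as) else none
      | (.const (.inr i'), [_, _, b]) => bif i'.beq i then some (v, b :: as) else none
      | _ => none
    | _ => none
  | .sigmaInd i _ => match as with
    | _ :: _ :: _ :: u :: x :: as => match wh x with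
      | (.const (.pair i'), [_, _, a, b]) => bif i'.beq i then some (u, a :: b :: as) else none
      | _ => none
    | _ => none
  | .idInd i _ => match as with
    | _ :: _ :: _ :: u :: _ :: x :: as => match wh x with
      | (.const (.refl i'), [_, _]) => bif i'.beq i then some (u, as) else none
      | _ => none
    | _ => none
  | .truncInd i _ => match as with
    | _ :: _ :: _ :: u :: x :: as => match wh x with
      | (.const (.tr i'), [_, a]) => bif i'.beq i then some (u, a :: as) else none
      | _ => none
    | _ => none
  | .brwInd i j => match as with
    | B :: L :: hB :: hL :: mz :: ms :: ml :: mb :: lz :: lt :: ls :: lc :: ll :: x :: as =>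
      match wh x with
      | (.const .bzero, []) => some (mz, as)
      | (.const .bsucc, [y]) =>
        some (ms, y :: (indApp (.brwInd i j) B L hB hL mz ms ml mb lz lt ls lc ll ⬝ₜ y) :: as)
      | (.const .blimit, [f]) => some (limitRhs i j B L hB hL mz ms ml mb lz lt ls lc ll f, as)
      | _ => none
    | _ => none
  | _ => none

/-- Weak head normal form of `t` applied to `as`, as a head and a list of arguments. -/
noncomputable def whnf : ℕ → Tm → List Tm → Tm × List Tm
  -- Without fuel the input is returned; it is convertible to itself, so soundness holds for every
  -- amount of fuel.
  | 0, t, as => (t, as)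
  | n + 1, t, as => match t with
    | .app f a => whnf n f (a :: as)
    | .lam A b => match as with
      | [] => (.lam A b, [])
      | a :: as => whnf n (instAt a 0 b) as
    | .const c => match iotaStep (fun x => whnf n x []) c as with
      | some (t, as) => whnf n t as
      | none => (.const c, as)
    | t => (t, as)

/-- Comparison of two lists of the same length. -/
def allTwo (p : Tm → Tm → Bool) : List Tm → List Tm → Bool
  | [], [] => true
  | a :: as, b :: bs => p a b && allTwo p as bs
  | _, _ => false

/-- A semidecision procedure for judgemental equality. -/
noncomputable def convb : ℕ → Tm → Tm → Bool
  | 0, _, _ => false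
  | n + 1, t, u => t.beq u || match whnf n t [], whnf n u [] with
    | (.pi A B, []), (.pi A' B', []) => convb n A A' && convb n B B'
    | (.lam A b, []), (.lam A' b', []) => convb n A A' && convb n b b'
    | (.lam _ b, []), (h, as) => convb n b (.app ((h.apps as).shift 1 0) (.var 0))
    | (h, as), (.lam _ b, []) => convb n (.app ((h.apps as).shift 1 0) (.var 0)) b
    | (.var k, as), (.var l, bs) => k.beq l && allTwo (convb n) as bs
    | (.const c, as), (.const d, bs) => decide (c = d) && allTwo (convb n) as bs
    | _, _ => false

/-- The level of a universe. -/
def asUniv : Tm × List Tm → Option ℕ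
  | (.univ i, []) => some i
  | _ => none

/-- Judgemental equality or inclusion of universes. -/
noncomputable def sub (n : ℕ) (A B : Tm) : Bool :=
  convb n A B || match asUniv (whnf n A []) with
    | some i => match asUniv (whnf n B []) with
      | some j => i.ble j
      | none => false
    | none => false

/-- The level of the universe that `T`, the type found for some term, evaluates to. -/
noncomputable def sortOf (n : ℕ) : Option Tm → Option ℕ
  | some T => asUniv (whnf n T [])
  | none => none

/-- Type inference, if no type is given, and type checking against a type that is given; the
result is the type of the term. `ok` says which constants may occur. -/
noncomputable def infer (ok : Const → Bool) : ℕ → List Tm → Tm → Option Tm → Option Tm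
  | 0, _, _, _ => none
  | n + 1, Γ, t, some E => match t, E with
    | .lam A b, .pi A' B' =>
      bif A.beq A' || (sortOf n (infer ok n Γ A none)).isSome && convb n A A' then
        match infer ok n (A :: Γ) b (some B') with
        | some _ => some E
        | none => none
      else none
    | t, E => match infer ok n Γ t none with
      | some A => bif sub n A E then some E else none
      | none => none
  | n + 1, Γ, t, none => match t with
    | .var k => match Γ[k]? with
      | some A => some (A.shift (k + 1) 0)
      | none => none
    | .univ i => some (.univ (i + 1))
    | .const c => bif ok c then some c.type else none
    | .pi A B => match sortOf n (infer ok n Γ A none) with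
      | some i => match sortOf n (infer ok n (A :: Γ) B none) with
        | some j => some (.univ (Nat.max i j))
        | none => none
      | none => none
    | .lam A b => match sortOf n (infer ok n Γ A none) with
      | some _ => match infer ok n (A :: Γ) b none with
        | some B => some (.pi A B)
        | none => none
      | none => none
    | .app f a => match infer ok n Γ f none with
      | some (.pi A B) => match infer ok n Γ a (some A) with
        | some _ => some (instAt a 0 B)
        | none => none
      | some T => match whnf n T [] with
        | (.pi A B, []) => match sortOf n (infer ok n Γ (.pi A B) none) with
          | some _ => match infer ok n Γ a (some A) with
            | some _ => some (instAt a 0 B)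
            | none => none
          | none => none
        | _ => none
      | none => none

/-- `A` can be seen to be a type. -/
noncomputable def checkType (ok : Const → Bool) (n : ℕ) (Γ : List Tm) (A : Tm) : Bool :=
  (sortOf n (infer ok n Γ A none)).isSome

/-- `t` can be seen to have type `A`, and `A` to be a type. -/
noncomputable def check (ok : Const → Bool) (n : ℕ) (Γ : List Tm) (t A : Tm) : Bool :=
  checkType ok n Γ A && (infer ok n Γ t (some A)).isSome

/-! ### Soundness of the type checker -/

theorem iotaStep_sound {wh : Tm → Tm × List Tm} (hwh : ∀ x, Conv x ((wh x).1.apps (wh x).2))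
    {c : Const} {as : List Tm} {r : Tm × List Tm} (h : iotaStep wh c as = some r) :
    Conv (Tm.apps (.const c) as) (r.1.apps r.2) := by
  -- The scrutinee `x` is evaluated in place, the rule fires on the constructor found, and the
  -- remaining arguments `a` are carried along.
  have key {t u x : Tm} {a : List Tm} {y : Tm × List Tm} (hx : wh x = y)
      (hs : Step (.app t (y.1.apps y.2)) u) : Conv (Tm.apps (.app t x) a) (u.apps a) :=
    Conv.apps ((Conv.app (.refl t) (hx ▸ hwh x)).trans (.step hs)) a
  cases c
  all_goals try contradiction
  all_goals
    simp only [iotaStep, cond_eq_ite] at h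
    repeat' split at h
    all_goals try contradiction
    all_goals
      cases h
      -- The level test of `iotaStep` identifies the level of the constructor with that of the
      -- eliminator, as the reduction rules demand.
      try simp only [Nat.beq_eq] at *
      subst_vars
      refine key (by assumption) ?_
      simp only [Tm.apps]
      constructor

theorem whnf_sound (n : ℕ) (t : Tm) (as : List Tm) :
    Conv (t.apps as) ((whnf n t as).1.apps (whnf n t as).2) := by
  induction n generalizing t as with
  | zero => exact .refl _
  | succ n ih =>
    rw [whnf.eq_def]
    dsimp only
    split
    · next f a => exact ih f (a :: as)
    · next A b =>
      split
      · exact .refl _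
      · next a as =>
        refine .trans (Conv.apps (t := .app (.lam A b) a) (.step ?_) as) (ih (instAt a 0 b) as)
        rw [instAt_zero_eq_inst]
        exact .beta ..
    · split
      · next h => exact (iotaStep_sound (fun x => ih x []) h).trans (ih ..)
      · exact .refl _
    · exact .refl _

theorem allTwo_sound {p : Tm → Tm → Bool} (hp : ∀ t u, p t u = true → Conv t u) {as bs : List Tm}
    (h : allTwo p as bs = true) {t u : Tm} (htu : Conv t u) : Conv (t.apps as) (u.apps bs) := by
  induction as generalizing bs t u with
  | nil => cases bs <;> simp_all [allTwo, Tm.apps]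
  | cons a as ih =>
    cases bs with
    | nil => simp [allTwo] at h
    | cons b bs =>
      simp only [allTwo, Bool.and_eq_true] at h
      exact ih h.2 (htu.app (hp _ _ h.1))

theorem convb_sound {n : ℕ} {t u : Tm} (h : convb n t u = true) : Conv t u := by
  induction n generalizing t u with
  | zero => simp [convb] at h
  | succ n ih =>
    rw [convb, Bool.or_eq_true] at h
    rcases h with h | h
    · exact eq_of_beq h ▸ .refl _
    · refine (whnf_sound n t []).trans (.trans ?_ (whnf_sound n u []).symm)
      -- The `η` rule leaves the domain annotation free, so it can be matched to that of the
      -- abstraction on the other side.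
      have eta {h : Tm} (A : Tm) : Conv (.lam A (.app (h.shift 1 0) (.var 0))) h := by
        rw [shift_zero_eq_lift]
        exact .step (.eta ..)
      split at h <;> (try simp only [Bool.and_eq_true, Nat.beq_eq, decide_eq_true_eq] at h) <;>
        try simp only [*, Tm.apps]
      · exact .pi (ih h.1) (ih h.2)
      · exact .lam (ih h.1) (ih h.2)
      · exact (Conv.lam (.refl _) (ih h)).trans (eta _)
      · exact (eta _).symm.trans (Conv.lam (.refl _) (ih h))
      · exact allTwo_sound (fun _ _ => ih) h.2 (.refl _)
      · exact allTwo_sound (fun _ _ => ih) h.2 (.refl _)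
      · simp at h

/-- Contexts all of whose entries are types. -/
inductive WF : List Tm → Prop
  | nil : WF []
  | cons {Γ : List Tm} {A : Tm} {i : ℕ} : WF Γ → HasType Γ A (.univ i) → WF (A :: Γ)

theorem WF.get {Γ : List Tm} (h : WF Γ) {k : ℕ} {A : Tm} (hk : Γ[k]? = some A) :
    ∃ i, HasType Γ (A.lift (k + 1)) (.univ i) := by
  induction h generalizing k with
  | nil => simp at hk
  | @cons Γ C _ hΓ hC ih =>
    cases k with
    | zero =>
      obtain rfl : C = A := by simpa using hk
      exact ⟨_, hC.lift_one _⟩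
    | succ k =>
      obtain ⟨i, hi⟩ := ih (by simpa using hk)
      have := hi.lift_one C
      rw [lift_lift] at this
      exact ⟨i, this⟩

theorem asUniv_eq_some {r : Tm × List Tm} {i : ℕ} (h : asUniv r = some i) : r = (.univ i, []) := by
  unfold asUniv at h
  split at h <;> simp_all

theorem HasType.of_asUniv {Γ : List Tm} {A T : Tm} {n i : ℕ} (h : HasType Γ A T)
    (hT : asUniv (whnf n T []) = some i) : HasType Γ A (.univ i) := by
  have := whnf_sound n T []
  rw [asUniv_eq_some hT] at this
  exact h.conv (.univ ..) this

/-- The constant has a type whose type is a universe. -/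
def Const.Good (c : Const) : Prop := ∃ i, HasType [] c.type (.univ i)

theorem Const.Good.hasType {c : Const} (h : c.Good) (Γ : List Tm) :
    ∃ i, HasType Γ c.type (.univ i) := by
  obtain ⟨i, hi⟩ := h
  have := hi.subst (Δ := Γ) (s := Tm.var) (by simp)
  rw [Const.subst_type] at this
  exact ⟨i, this⟩

theorem infer_some {ok : Const → Bool} {n : ℕ} {Γ : List Tm} {t A E : Tm}
    (h : infer ok n Γ t (some E) = some A) : A = E := by
  cases n with
  | zero => simp [infer] at h
  | succ n =>
    rw [infer.eq_def] at h
    simp only [cond_eq_ite] at h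
    repeat' split at h
    all_goals simp_all

theorem HasType.of_sub {Γ : List Tm} {t A B : Tm} {n i : ℕ} (h : HasType Γ t A)
    (hB : HasType Γ B (.univ i)) (hs : sub n A B = true) : HasType Γ t B := by
  rw [sub, Bool.or_eq_true] at hs
  rcases hs with hs | hs
  · exact h.conv hB (convb_sound hs)
  · split at hs <;> [skip; cases hs]
    next j hj =>
    split at hs <;> [skip; cases hs]
    next k hk =>
    have hc := whnf_sound n B []
    rw [asUniv_eq_some hk] at hc
    exact ((h.of_asUniv hj).cumul_le (Nat.le_of_ble_eq_true hs)).conv hB hc.symm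

/-- The identity is a well-typed substitution between the two contexts: variable `0` is retyped by
conversion, and the others keep their types. -/
theorem HasType.conv_ctx {Γ : List Tm} {A A' t T : Tm} {i : ℕ} (h : HasType (A' :: Γ) t T)
    (hA' : HasType Γ A' (.univ i)) (hc : Conv A A') : HasType (A :: Γ) t T := by
  have := h.subst (Δ := A :: Γ) (s := Tm.var) fun n C hn => by
    rw [subst_var]
    cases n with
    | zero =>
      obtain rfl : A' = C := by simpa using hn
      exact (HasType.var rfl).conv (hA'.lift_one A) (hc.lift 1)
    | succ n => exact .var (by simpa using hn)
  simpa [subst_var] using this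

/-- The induction on fuel also carries the fact that the resulting type lies in a universe: the
conversion rule and the checking of arguments both require it. -/
theorem infer_sound {ok : Const → Bool} (hok : ∀ c, ok c = true → c.Good) {n : ℕ} {Γ : List Tm}
    (hΓ : WF Γ) {t A : Tm} {E : Option Tm} (h : infer ok n Γ t E = some A)
    (hE : ∀ B ∈ E, ∃ i, HasType Γ B (.univ i)) :
    HasType Γ t A ∧ ∃ i, HasType Γ A (.univ i) := by
  induction n generalizing Γ t A E with
  | zero => simp [infer] at h
  | succ n ih =>
    have ihn {Γ : List Tm} (hΓ : WF Γ) {t A : Tm} (h : infer ok n Γ t none = some A) :=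
      ih hΓ h (by simp)
    have ihs {Γ : List Tm} (hΓ : WF Γ) {A : Tm} {i : ℕ}
        (h : sortOf n (infer ok n Γ A none) = some i) : HasType Γ A (.univ i) := by
      unfold sortOf at h
      split at h <;> [skip; cases h]
      next hT => exact (ihn hΓ hT).1.of_asUniv h
    have happ {f a A B C : Tm} {i : ℕ} (hf : HasType Γ f (.pi A B))
        (hT : HasType Γ (.pi A B) (.univ i)) (ha : infer ok n Γ a (some A) = some C) :
        HasType Γ (.app f a) (instAt a 0 B) ∧ ∃ i, HasType Γ (instAt a 0 B) (.univ i) := by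
      obtain ⟨j, h₁, h₂⟩ := hT.pi_inv
      have ha' := (ih hΓ ha (by simpa using ⟨j, h₁⟩)).1
      obtain rfl : C = A := infer_some ha
      rw [instAt_zero_eq_inst]
      exact ⟨hf.app ha', j, h₂.inst ha'⟩
    cases E with
    | some E =>
      obtain ⟨i, hE⟩ := hE E rfl
      obtain rfl := infer_some h
      refine ⟨?_, i, hE⟩
      rw [infer.eq_def] at h
      simp only [cond_eq_ite] at h
      split at h
      · next A b A' B' _ =>
        split at h <;> [skip; cases h]
        next hc =>
        split at h <;> [skip; cases h]
        next hb =>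
        obtain ⟨k, h₁, h₂⟩ := hE.pi_inv
        obtain ⟨hc, j, hA⟩ : Conv A A' ∧ ∃ j, HasType Γ A (.univ j) := by
          rw [Bool.or_eq_true, Bool.and_eq_true] at hc
          rcases hc with hc | hc
          · obtain rfl := eq_of_beq hc
            exact ⟨.refl _, k, h₁⟩
          · obtain ⟨j, hj⟩ := Option.isSome_iff_exists.mp hc.1
            exact ⟨convb_sound hc.2, j, ihs hΓ hj⟩
        -- The body was checked under the annotation `A`, while the codomain `B'` is known to be a
        -- type only over the expected domain `A'`.
        have hB := h₂.conv_ctx h₁ hc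
        have hb' := (ih (hΓ.cons hA) hb (by simpa using ⟨k, hB⟩)).1
        obtain rfl := infer_some hb
        exact (hA.lam hb').conv hE (.pi hc (.refl _))
      · split at h <;> [skip; cases h]
        next hA =>
        split at h <;> [skip; cases h]
        next hs => exact (ihn hΓ hA).1.of_sub hE hs
    | none =>
      rw [infer.eq_def] at h
      simp only [cond_eq_ite] at h
      split at h
      · split at h <;> cases h
        next hk =>
        rw [shift_zero_eq_lift]
        exact ⟨.var hk, hΓ.get hk⟩
      · cases h
        exact ⟨.univ .., _, .univ ..⟩
      · split at h <;> cases h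
        next hc => exact ⟨.const .., (hok _ hc).hasType Γ⟩
      · split at h <;> [skip; cases h]
        next i hi =>
        split at h <;> cases h
        next j hj =>
        have hA := ihs hΓ hi
        exact ⟨.pi (hA.cumul_le (le_max_left i j))
          ((ihs (hΓ.cons hA) hj).cumul_le (le_max_right i j)), _, .univ ..⟩
      · split at h <;> [skip; cases h]
        next i hi =>
        split at h <;> cases h
        next hb =>
        have hA := ihs hΓ hi
        obtain ⟨hb, j, hB⟩ := ihn (hΓ.cons hA) hb
        exact ⟨.lam hA hb, _, .pi (hA.cumul_le (le_max_left i j)) (hB.cumul_le (le_max_right i j))⟩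
      · split at h
        · next hf =>
          split at h <;> cases h
          next ha =>
          obtain ⟨hf, i, hT⟩ := ihn hΓ hf
          exact happ hf hT ha
        -- In the absence of subject reduction, the product to which `T` evaluates is not known to
        -- be a type; the checker has verified this separately.
        · next T _ hf =>
          split at h <;> [skip; cases h]
          next hw =>
          split at h <;> [skip; cases h]
          next hP =>
          split at h <;> cases h
          next ha =>
          have hP := ihs hΓ hP
          have := whnf_sound n T []
          rw [hw] at this
          exact happ ((ihn hΓ hf).1.conv hP this) hP ha
        · cases h

theorem HasType.of_checkType {ok : Const → Bool} (hok : ∀ c, ok c = true → c.Good) {n : ℕ}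
    {Γ : List Tm} (hΓ : WF Γ) {A : Tm} (h : checkType ok n Γ A = true) :
    ∃ i, HasType Γ A (.univ i) := by
  obtain ⟨i, hi⟩ := Option.isSome_iff_exists.mp h
  unfold sortOf at hi
  split at hi <;> [skip; cases hi]
  next hA => exact ⟨i, (infer_sound hok hΓ hA (by simp)).1.of_asUniv hi⟩

theorem HasType.of_check {ok : Const → Bool} (hok : ∀ c, ok c = true → c.Good) {n : ℕ}
    {Γ : List Tm} (hΓ : WF Γ) {t A : Tm} (h : check ok n Γ t A = true) :
    HasType Γ t A ∧ ∃ i, HasType Γ A (.univ i) := by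
  rw [check, Bool.and_eq_true] at h
  have hA := HasType.of_checkType hok hΓ h.1
  obtain ⟨B, hB⟩ := Option.isSome_iff_exists.mp h.2
  have := infer_sound hok hΓ hB (by simpa using hA)
  rwa [infer_some hB] at this

/-! ### The types of the constants are well formed -/

/-- The position of a constant in an order in which the type of each constant only mentions
earlier ones; the constants that are not needed come last. -/
def Const.stage : Const → ℕ
  | .empty | .two | .nat | .brw | .sum 0 => 0
  | .sigma i | .id i => bif i.blt 2 then 0 else 9
  | .trunc 0 => 0
  | .ff | .tt | .zero | .suc | .bzero | .bsucc | .leq | .emptyInd 0 | .inl 0 | .inr 0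
  | .tr 0 | .trEq 0 | .funext 0 | .brwSet => 1
  | .pair i | .refl i => bif i.blt 2 then 1 else 9
  | .natInd 0 | .sumInd 0 0 | .truncInd 0 0
  | .leqZero | .leqTrans | .leqSuccMono | .leqProp => 2
  | .twoInd i => bif i.blt 2 then 2 else 9
  | .sigmaInd i j | .idInd i j => bif i.blt 2 && j.blt 2 then 2 else 9
  | .univalence 0 | .blimit => 3
  | .bisim | .leqCocone | .leqLimiting => 4
  | .brwInd i 0 => bif i.blt 2 then 5 else 9
  | .leqInd 1 0 => 6
  | _ => 9

/-- The constants of stage less than `9`. -/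
def Const.list : List Const :=
  [empty, two, nat, brw, sum 0, sigma 0, sigma 1, id 0, id 1, trunc 0,
   ff, tt, zero, suc, bzero, bsucc, leq, emptyInd 0, inl 0, inr 0, tr 0, trEq 0, funext 0, brwSet,
   pair 0, pair 1, refl 0, refl 1, natInd 0, sumInd 0 0, truncInd 0 0,
   leqZero, leqTrans, leqSuccMono, leqProp, twoInd 0, twoInd 1, sigmaInd 0 0, sigmaInd 0 1,
   sigmaInd 1 0, sigmaInd 1 1, idInd 0 0, idInd 0 1, idInd 1 0, idInd 1 1, univalence 0, blimit,
   bisim, leqCocone, leqLimiting, brwInd 0 0, brwInd 1 0, leqInd 1 0]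

theorem Const.mem_list {c : Const} (h : c.stage.blt 9 = true) : c ∈ Const.list := by
  unfold Const.stage at h
  split at h
  all_goals
    first
    | simp [Const.list]; done
    | simp at h; done
    | simp only [cond_eq_ite, Nat.blt_eq, Bool.and_eq_true] at h
      split_ifs at h
      · next hi =>
        first
        | obtain ⟨hi, hj⟩ := hi
          (repeat' rw [Nat.lt_succ_iff_lt_or_eq, Nat.lt_one_iff] at hi hj)
          rcases hi with rfl | rfl <;> rcases hj with rfl | rfl <;> simp [Const.list]
        | rw [Nat.lt_succ_iff_lt_or_eq, Nat.lt_one_iff] at hi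
          rcases hi with rfl | rfl <;> simp [Const.list]
      · simp at h

/-- Soundness of the checker presupposes that the constants it admits have well-formed types.
Admitting only those of an earlier stage avoids circularity and permits the strong induction in
`Const.good`. -/
theorem Const.list_checkType : Const.list.all (fun c =>
    checkType (fun d => d.stage.blt c.stage) 1000 [] c.type) = true := by
  decide +kernel

theorem Const.good {c : Const} (h : c.stage.blt 9 = true) : c.Good := by
  induction hn : c.stage using Nat.strong_induction_on generalizing c with
  | _ n ih =>
    have := List.all_eq_true.mp Const.list_checkType c (Const.mem_list h)
    refine HasType.of_checkType (fun d hd => ?_) .nil this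
    have hdc : d.stage < c.stage := by simpa using hd
    refine ih d.stage (hn ▸ hdc) ?_ rfl
    simp only [Nat.blt_eq] at h ⊢
    omega

/-- `t` can be seen to have type `A` in the context `Γ`. -/
noncomputable def derives (Γ : List Tm) (t A : Tm) : Bool :=
  check (fun c => c.stage.blt 9) 1000 Γ t A

theorem HasType.of_derives {Γ : List Tm} (hΓ : WF Γ) {t A : Tm} (h : derives Γ t A = true) :
    HasType Γ t A ∧ ∃ i, HasType Γ A (.univ i) :=
  HasType.of_check (fun _ => Const.good) hΓ h

/-! ### From a list of lemmas to a closed term -/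

/-- Closed types that are inhabited in the context `Γ` are inhabited. -/
structure Realizes (Γ : List Tm) : Prop where
  wf : WF Γ
  holds : ∀ t A, A.closedAt 0 = true → HasType Γ t A → ∃ u, HasType [] u A

theorem Realizes.nil : Realizes [] := ⟨.nil, fun t _ _ h => ⟨t, h⟩⟩

theorem Realizes.cons {Γ : List Tm} (h : Realizes Γ) {t A : Tm} (ht : derives Γ t A = true) :
    Realizes (A :: Γ) := by
  obtain ⟨ht, i, hA⟩ := HasType.of_derives h.wf ht
  refine ⟨h.wf.cons hA, fun u B hB hu => h.holds (u.inst t) B hB ?_⟩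
  have := hu.inst ht
  -- Substituting the proof `t` for the newest hypothesis removes it from the context and leaves the
  -- closed type `B` unchanged.
  have e : B.inst t = B := subst_of_closedAt hB (by simp)
  rwa [e] at this

/-- Each of the given terms has the type paired with it, in the context of the types before it; `d`
is the length of the context `Γ`. -/
noncomputable def derivesAll : ℕ → List Tm → List (Ex × Ex) → Bool
  | _, _, [] => true
  | d, Γ, (A, t) :: l => derives Γ (t d) (A d) && derivesAll (d + 1) (A d :: Γ) l

theorem Realizes.of_derivesAll {Γ : List Tm} (h : Realizes Γ) {d : ℕ} {l : List (Ex × Ex)}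
    (hl : derivesAll d Γ l = true) {A t : Ex} (n : ℕ) (hn : l[n]? = some (A, t))
    (hA : (A (d + n)).closedAt 0 = true) : ∃ u, HasType [] u (A (d + n)) := by
  induction l generalizing Γ d n with
  | nil => simp at hn
  | cons p l ih =>
    rw [derivesAll, Bool.and_eq_true] at hl
    cases n with
    | zero =>
      obtain rfl : p = (A, t) := by simpa using hn
      exact h.holds _ _ hA (HasType.of_derives h.wf hl.1).1
    | succ n =>
      have e : d + (n + 1) = d + 1 + n := by omega
      rw [e] at hA ⊢
      exact ih (h.cons hl.1) hl.2 n (by simpa using hn) hA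

/-! ### Eliminators with explicit motives

The terms below are checked in a context that lists theorems of type theory. For a theorem `foo`,
`fooTy` is its statement and `fooTm` its proof; later proofs refer to it as a variable, whose level
is the position of the theorem in `library`. -/

/-- Elimination of `p : a = b` into the family `P`. -/
def J (i j : ℕ) (A a : Ex) (P : Ex → Ex → Ex) (u b p : Ex) : Ex :=
  C (.idInd i j) ⬝ A ⬝ a ⬝ Lam A (fun y => Lam (Eq' i A a y) fun q => P y q) ⬝ u ⬝ b ⬝ p
/-- Transport along `p : a = b` in the family `P`. -/
def Tr (i j : ℕ) (A : Ex) (P : Ex → Ex) (a b p u : Ex) : Ex := Transport i j A (Lam A P) a b p u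
def NatRec (P : Ex → Ex) (u : Ex) (v : Ex → Ex → Ex) (n : Ex) : Ex :=
  C (.natInd 0) ⬝ Lam Nat' P ⬝ u ⬝ Lam Nat' (fun n => Lam (P n) fun h => v n h) ⬝ n
def TwoRec (P : Ex → Ex) (u v b : Ex) : Ex := C (.twoInd 0) ⬝ Lam (C .two) P ⬝ u ⬝ v ⬝ b
def SumRec (A B : Ex) (P : Ex → Ex) (u v : Ex → Ex) (x : Ex) : Ex :=
  C (.sumInd 0 0) ⬝ A ⬝ B ⬝ Lam (Sum' 0 A B) P ⬝ Lam A u ⬝ Lam B v ⬝ x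
def Inl (A B a : Ex) : Ex := C (.inl 0) ⬝ A ⬝ B ⬝ a
def Inr (A B b : Ex) : Ex := C (.inr 0) ⬝ A ⬝ B ⬝ b
def Absurd (A x : Ex) : Ex := C (.emptyInd 0) ⬝ Lam (C .empty) (fun _ => A) ⬝ x
/-- Elimination of an existential statement into the proposition `P`. -/
def ExRec (A : Ex) (B : Ex → Ex) (P hP : Ex) (u : Ex → Ex → Ex) (x : Ex) : Ex :=
  C (.truncInd 0 0) ⬝ Sig 0 A B ⬝ Lam (Exist 0 A B) (fun _ => P) ⬝ Lam (Exist 0 A B) (fun _ => hP)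
    ⬝ Lam (Sig 0 A B) (fun w => Lam A (fun a => Lam (B a) fun b => u a b)
      ⬝ Fst 0 A B w ⬝ Snd 0 A B w) ⬝ x
def ExIntro (A : Ex) (B : Ex → Ex) (a b : Ex) : Ex := C (.tr 0) ⬝ Sig 0 A B ⬝ Pair 0 A B a b
def ExProp (A : Ex) (B : Ex → Ex) : Ex := C (.trEq 0) ⬝ Sig 0 A B

/-! ### Sets and propositions -/

/-- A type with a reflexive and antisymmetric proposition-valued relation is a set. -/
def setOfRelTy (i : ℕ) : Ex := Pi (U i) fun A => Pi (A ⇒ A ⇒ U i) fun R =>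
  (Pi A fun x => Pi A fun y => IsProp i (R ⬝ x ⬝ y)) ⇒ (Pi A fun x => R ⬝ x ⬝ x) ⇒
  (Pi A fun x => Pi A fun y => R ⬝ x ⬝ y ⇒ R ⬝ y ⬝ x ⇒ Eq' i A x y) ⇒ IsSet i A
-- A Hedberg-style argument. From `s : R x z` and `t : R z x` the term `G` builds a path `x = z`,
-- normalized by the inverse of the path obtained at reflexivity. Path induction shows that every `p
-- : x = y` equals `G` at the transports of reflexivity along `p`; as `R` is proposition-valued,
-- these do not depend on `p`.
def setOfRelTm (i : ℕ) : Ex := Lam (U i) fun A => Lam (A ⇒ A ⇒ U i) fun R =>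
  Lam (Pi A fun x => Pi A fun y => IsProp i (R ⬝ x ⬝ y)) fun hR =>
  Lam (Pi A fun x => R ⬝ x ⬝ x) fun r =>
  Lam (Pi A fun x => Pi A fun y => R ⬝ x ⬝ y ⇒ R ⬝ y ⬝ x ⇒ Eq' i A x y) fun f =>
  Lam A fun x => Lam A fun y => Lam (Eq' i A x y) fun p => Lam (Eq' i A x y) fun q =>
  let comp (z e e' : Ex) : Ex := Tr i i A (fun w => Eq' i A w z) x z e e'
  let comp' (z e e' : Ex) : Ex := Tr i i A (fun w => Eq' i A w z) x x e e'
  let G (z s t : Ex) : Ex := comp' z (f ⬝ x ⬝ x ⬝ (r ⬝ x) ⬝ (r ⬝ x)) (f ⬝ x ⬝ z ⬝ s ⬝ t)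
  let fwd (z e : Ex) : Ex := Tr i i A (fun w => R ⬝ x ⬝ w) x z e (r ⬝ x)
  let bwd (z e : Ex) : Ex := Tr i i A (fun w => R ⬝ w ⬝ x) x z e (r ⬝ x)
  let inv (e : Ex) : Ex := J i i A x
    (fun z e => Eq' i (Eq' i A z z) (comp z e e) (Refl i A z))
    (Refl i (Eq' i A x x) (Refl i A x)) x e
  let G_eq (e : Ex) : Ex := J i i A x (fun z e => Eq' i (Eq' i A x z) (G z (fwd z e) (bwd z e)) e)
    (inv (f ⬝ x ⬝ x ⬝ (r ⬝ x) ⬝ (r ⬝ x))) y e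
  Tr i i (Eq' i A x y) (fun e => Eq' i (Eq' i A x y) e q) (G y (fwd y p) (bwd y p)) p (G_eq p)
    (Tr i i (R ⬝ y ⬝ x) (fun t => Eq' i (Eq' i A x y) (G y (fwd y p) t) q) (bwd y q) (bwd y p)
      (hR ⬝ y ⬝ x ⬝ bwd y q ⬝ bwd y p)
      (Tr i i (R ⬝ x ⬝ y) (fun s => Eq' i (Eq' i A x y) (G y s (bwd y q)) q) (fwd y q) (fwd y p)
        (hR ⬝ x ⬝ y ⬝ fwd y q ⬝ fwd y p) (G_eq q)))

/-- The instances for the universe levels `0` and `1` are the entries `0` and `1` of `library`, so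
the level is also the position. -/
def setOfRel : ℕ → Ex := bvar

def setOfPropTy : Ex := Pi (U 0) fun A => IsProp 0 A ⇒ IsSet 0 A
-- The relation is constantly `A`: any point `x` proves it at `(x, x)`, and antisymmetry is the
-- hypothesis that `A` is a proposition.
def setOfPropTm : Ex := Lam (U 0) fun A => Lam (IsProp 0 A) fun h =>
  setOfRel 0 ⬝ A ⬝ (Lam A fun _ => Lam A fun _ => A) ⬝ (Lam A fun _ => Lam A fun _ => h)
    ⬝ (Lam A fun x => x) ⬝ (Lam A fun x => Lam A fun y => Lam A fun _ => Lam A fun _ => h ⬝ x ⬝ y)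
def setOfProp : Ex := bvar 2

def propPiTy : Ex := Pi (U 0) fun A => Pi (A ⇒ U 0) fun B =>
  (Pi A fun x => IsProp 0 (B ⬝ x)) ⇒ IsProp 0 (Pi A fun x => B ⬝ x)
def propPiTm : Ex := Lam (U 0) fun A => Lam (A ⇒ U 0) fun B =>
  Lam (Pi A fun x => IsProp 0 (B ⬝ x)) fun h =>
  Lam (Pi A fun x => B ⬝ x) fun f => Lam (Pi A fun x => B ⬝ x) fun g =>
  C (.funext 0) ⬝ A ⬝ B ⬝ f ⬝ g ⬝ Lam A fun x => h ⬝ x ⬝ (f ⬝ x) ⬝ (g ⬝ x)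
def propPi (A : Ex) (B : Ex → Ex) (h : Ex → Ex) : Ex := bvar 3 ⬝ A ⬝ Lam A B ⬝ Lam A h

def propIsPropTy : Ex := Pi (U 0) fun A => IsProp 0 (IsProp 0 A)
def propIsPropTm : Ex := Lam (U 0) fun A => Lam (IsProp 0 A) fun p => Lam (IsProp 0 A) fun q =>
  propPi A (fun x => Pi A fun y => Eq' 0 A x y)
    (fun x => propPi A (fun y => Eq' 0 A x y) fun y => setOfProp ⬝ A ⬝ p ⬝ x ⬝ y) ⬝ p ⬝ q
def propIsProp : Ex := bvar 4

/-- Cumulativity does not relate the identity types of different levels, which are formed with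
distinct constants; path induction passes from one to the other. -/
def propUpTy : Ex := Pi (U 0) fun A => IsProp 0 A ⇒ IsProp 1 A
def propUpTm : Ex := Lam (U 0) fun A => Lam (IsProp 0 A) fun h => Lam A fun x => Lam A fun y =>
  J 0 1 A x (fun y _ => Eq' 1 A x y) (Refl 1 A x) y (h ⬝ x ⬝ y)
def propUp : Ex := bvar 5

def propEmptyTy : Ex := IsProp 0 (C .empty)
def propEmptyTm : Ex := Lam (C .empty) fun x => Lam (C .empty) fun y =>
  Absurd (Eq' 0 (C .empty) x y) x
def propEmpty : Ex := bvar 6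

def propSumTy : Ex := Pi (U 0) fun A => Pi (U 0) fun B => IsProp 0 A ⇒ IsProp 0 B ⇒
  (A ⇒ B ⇒ C .empty) ⇒ IsProp 0 (Sum' 0 A B)
def propSumTm : Ex := Lam (U 0) fun A => Lam (U 0) fun B =>
  Lam (IsProp 0 A) fun hA => Lam (IsProp 0 B) fun hB => Lam (A ⇒ B ⇒ C .empty) fun n =>
  Lam (Sum' 0 A B) fun x => Lam (Sum' 0 A B) fun y =>
  let eq (x y : Ex) : Ex := Eq' 0 (Sum' 0 A B) x y
  SumRec A B (fun x => eq x y)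
    (fun a => SumRec A B (fun y => eq (Inl A B a) y)
      (fun a' => J 0 0 A a (fun z _ => eq (Inl A B a) (Inl A B z))
        (Refl 0 (Sum' 0 A B) (Inl A B a)) a' (hA ⬝ a ⬝ a'))
      (fun b => Absurd (eq (Inl A B a) (Inr A B b)) (n ⬝ a ⬝ b)) y)
    (fun b => SumRec A B (fun y => eq (Inr A B b) y)
      (fun a => Absurd (eq (Inr A B b) (Inl A B a)) (n ⬝ a ⬝ b))
      (fun b' => J 0 0 B b (fun z _ => eq (Inr A B b) (Inr A B z))
        (Refl 0 (Sum' 0 A B) (Inr A B b)) b' (hB ⬝ b ⬝ b')) y) x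
def propSum : Ex := bvar 7

/-! ### The set of propositions -/

/-- The type of propositions. -/
def HProp : Ex := Sig 1 (U 0) fun X => IsProp 0 X
def el (P : Ex) : Ex := Fst 1 (U 0) (fun X => IsProp 0 X) P
def elProp (P : Ex) : Ex := Snd 1 (U 0) (fun X => IsProp 0 X) P
def mkProp (X h : Ex) : Ex := Pair 1 (U 0) (fun X => IsProp 0 X) X h

def propUnivTy : Ex := Pi (U 0) fun X => Pi (U 0) fun Y => IsProp 0 X ⇒ IsProp 0 Y ⇒
  (X ⇒ Y) ⇒ (Y ⇒ X) ⇒ Eq' 1 (U 0) X Y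
def propUnivTm : Ex := Lam (U 0) fun X => Lam (U 0) fun Y =>
  Lam (IsProp 0 X) fun hX => Lam (IsProp 0 Y) fun hY => Lam (X ⇒ Y) fun f => Lam (Y ⇒ X) fun g =>
  let E := Eq' 1 (U 0) X Y
  let V := Equiv' 0 X Y
  let F := IdToEquiv 0 X Y
  Fst 1 (V ⇒ E) (fun g => Pi V fun y => Eq' 1 V (F ⬝ (g ⬝ y)) y)
    (Fst 1 (RInv 1 E V F) (fun _ => LInv 1 E V F) (C (.univalence 0) ⬝ X ⬝ Y))
    ⬝ Pair 0 (X ⇒ Y) (fun f => IsEquiv 0 X Y f) f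
      (Pair 0 (RInv 0 X Y f) (fun _ => LInv 0 X Y f)
        (Pair 0 (Y ⇒ X) (fun g => Pi Y fun y => Eq' 0 Y (f ⬝ (g ⬝ y)) y) g
          (Lam Y fun y => hY ⬝ (f ⬝ (g ⬝ y)) ⬝ y))
        (Pair 0 (Y ⇒ X) (fun g => Pi X fun x => Eq' 0 X (g ⬝ (f ⬝ x)) x) g
          (Lam X fun x => hX ⬝ (g ⬝ (f ⬝ x)) ⬝ x)))
def propUniv : Ex := bvar 8

def mkPropEqTy : Ex := Pi (U 0) fun X => Pi (IsProp 0 X) fun p => Pi (U 0) fun Y =>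
  Eq' 1 (U 0) X Y ⇒ Pi (IsProp 0 Y) fun q => Eq' 1 HProp (mkProp X p) (mkProp Y q)
def mkPropEqTm : Ex := Lam (U 0) fun X => Lam (IsProp 0 X) fun p => Lam (U 0) fun Y =>
  Lam (Eq' 1 (U 0) X Y) fun e =>
  J 1 1 (U 0) X (fun Y _ => Pi (IsProp 0 Y) fun q => Eq' 1 HProp (mkProp X p) (mkProp Y q))
    (Lam (IsProp 0 X) fun q =>
      Tr 0 1 (IsProp 0 X) (fun r => Eq' 1 HProp (mkProp X p) (mkProp X r)) p q
        (propIsProp ⬝ X ⬝ p ⬝ q) (Refl 1 HProp (mkProp X p))) Y e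
def mkPropEq : Ex := bvar 9

def propExtTy : Ex := Pi HProp fun P => Pi HProp fun Q =>
  (el P ⇒ el Q) ⇒ (el Q ⇒ el P) ⇒ Eq' 1 HProp P Q
def propExtTm : Ex :=
  -- There is no judgemental `η` for pairs, so `P` and `Q` must first be replaced by explicit pairs.
  let ind (M : Ex → Ex) (u : Ex → Ex → Ex) : Ex :=
    C (.sigmaInd 1 1) ⬝ U 0 ⬝ Lam (U 0) (fun X => IsProp 0 X) ⬝ Lam HProp M
      ⬝ Lam (U 0) fun X => Lam (IsProp 0 X) fun p => u X p
  ind (fun P => Pi HProp fun Q => (el P ⇒ el Q) ⇒ (el Q ⇒ el P) ⇒ Eq' 1 HProp P Q) fun X p =>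
  ind (fun Q => (X ⇒ el Q) ⇒ (el Q ⇒ X) ⇒ Eq' 1 HProp (mkProp X p) Q) fun Y q =>
  Lam (X ⇒ Y) fun f => Lam (Y ⇒ X) fun g =>
  mkPropEq ⬝ X ⬝ p ⬝ Y ⬝ (propUniv ⬝ X ⬝ Y ⬝ p ⬝ q ⬝ f ⬝ g) ⬝ q
def propExt : Ex := bvar 10

def setHPropTy : Ex := IsSet 1 HProp
-- Implication is a reflexive proposition-valued relation on `HProp`, and it is antisymmetric by
-- propositional extensionality.
def setHPropTm : Ex :=
  setOfRel 1 ⬝ HProp ⬝ (Lam HProp fun P => Lam HProp fun Q => el P ⇒ el Q)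
    ⬝ (Lam HProp fun P => Lam HProp fun Q =>
        propUp ⬝ (el P ⇒ el Q) ⬝ propPi (el P) (fun _ => el Q) fun _ => elProp Q)
    ⬝ (Lam HProp fun P => Lam (el P) fun x => x)
    ⬝ propExt
def setHProp : Ex := bvar 11

/-! ### Induction on Brouwer trees -/

def transportConstTy : Ex := Pi Brw fun x => Pi Brw fun y => Pi (Eq' 0 Brw x y) fun p =>
  Pi HProp fun u => Pi HProp fun w =>
    Eq' 1 HProp u w ⇒ Eq' 1 HProp (Tr 0 1 Brw (fun _ => HProp) x y p u) w
def transportConstTm : Ex := Lam Brw fun x => Lam Brw fun y => Lam (Eq' 0 Brw x y) fun p =>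
  J 0 1 Brw x (fun y p => Pi HProp fun u => Pi HProp fun w =>
    Eq' 1 HProp u w ⇒ Eq' 1 HProp (Tr 0 1 Brw (fun _ => HProp) x y p u) w)
    (Lam HProp fun u => Lam HProp fun w => Lam (Eq' 1 HProp u w) fun e => e) y p
def transportConst : Ex := bvar 12

/-- The hypothesis has the shape of an inductive premise of `bisim`: the witness `n` comes with an
inequality, here `T k n`, that plays no role in the implication. -/
def exMapTy : Ex := Pi (Nat' ⇒ HProp) fun u => Pi (Nat' ⇒ HProp) fun v =>
  Pi (Nat' ⇒ Nat' ⇒ U 0) fun T =>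
  (Pi Nat' fun k => Exist 0 Nat' fun n => Sig 0 (T ⬝ k ⬝ n) fun _ => el (u ⬝ k) ⇒ el (v ⬝ n)) ⇒
  (Exist 0 Nat' fun k => el (u ⬝ k)) ⇒ Exist 0 Nat' fun n => el (v ⬝ n)
def exMapTm : Ex := Lam (Nat' ⇒ HProp) fun u => Lam (Nat' ⇒ HProp) fun v =>
  Lam (Nat' ⇒ Nat' ⇒ U 0) fun T =>
  Lam (Pi Nat' fun k => Exist 0 Nat' fun n => Sig 0 (T ⬝ k ⬝ n) fun _ => el (u ⬝ k) ⇒ el (v ⬝ n))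
    fun h =>
  Lam (Exist 0 Nat' fun k => el (u ⬝ k)) fun e =>
  let B (n : Ex) : Ex := el (v ⬝ n)
  ExRec Nat' (fun k => el (u ⬝ k)) (Exist 0 Nat' B) (ExProp Nat' B) (fun k a =>
    ExRec Nat' (fun n => Sig 0 (T ⬝ k ⬝ n) fun _ => el (u ⬝ k) ⇒ el (v ⬝ n))
      (Exist 0 Nat' B) (ExProp Nat' B)
      (fun n w => ExIntro Nat' B n
        (Snd 0 (T ⬝ k ⬝ n) (fun _ => el (u ⬝ k) ⇒ el (v ⬝ n)) w ⬝ a)) (h ⬝ k)) e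
def exMap : Ex := bvar 13

/-- Application of `brwInd` or `leqInd` to the methods that define the predicate `a < x` by
recursion on `x`: it is false for `zero`, it is `a ≤ x` for `succ x`, and for `limit f` it says
that `a < f k` for some `k`. -/
def ltInd (c : Const) (a : Ex) : Ex :=
  let Over : Ex := Nat' ⇒ HProp
  -- The predicate at `succ (f n)` is `a ≤ f n`, whatever its value at `f n`; hence the premise of
  -- this implication.
  let IncrOver (f u : Ex) : Ex := Pi Nat' fun n => Leq a (nth f n) ⇒ el (u ⬝ S n)
  let SimOver (f u g v : Ex) : Ex := Pi Nat' fun k => Exist 0 Nat' fun n =>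
    Sig 0 (Leq (nth f k) (nth g n)) fun _ => el (u ⬝ k) ⇒ el (v ⬝ n)
  let some (u : Ex) : Ex := Exist 0 Nat' fun k => el (u ⬝ k)
  let someProp (u : Ex) : Ex := mkProp (some u) (ExProp Nat' fun k => el (u ⬝ k))
  indAp c (Lam Brw fun _ => HProp)
    (Lam Brw fun x => Lam Brw fun y => Lam HProp fun u => Lam HProp fun v => Lam (Leq x y) fun _ =>
      el u ⇒ el v)
    (Lam Brw fun _ => setHProp)
    (Lam Brw fun x => Lam Brw fun y => Lam HProp fun u => Lam HProp fun v => Lam (Leq x y) fun _ =>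
      propPi (el u) (fun _ => el v) fun _ => elProp v)
    (mkProp (C .empty) propEmpty)
    (Lam Brw fun x => Lam HProp fun _ => mkProp (Leq a x) (C .leqProp ⬝ a ⬝ x))
    (Lam Incr fun f => Lam Over fun u => Lam (IncrOver f u) fun _ => someProp u)
    (Lam Incr fun f => Lam Over fun u => Lam (IncrOver f u) fun _ =>
      Lam Incr fun g => Lam Over fun v => Lam (IncrOver g v) fun _ =>
      Lam (Bisim f g) fun s => Lam (SimOver f u g v) fun h => Lam (SimOver g v f u) fun h' =>
      -- The motive is constant, so the equation over `bisim` reduces to propositional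
      -- extensionality; the two simulations give the two implications.
      transportConst ⬝ (C .blimit ⬝ f) ⬝ (C .blimit ⬝ g) ⬝ (C .bisim ⬝ f ⬝ g ⬝ s)
        ⬝ someProp u ⬝ someProp v
        ⬝ (propExt ⬝ someProp u ⬝ someProp v
          ⬝ (exMap ⬝ u ⬝ v ⬝ (Lam Nat' fun k => Lam Nat' fun n => Leq (nth f k) (nth g n)) ⬝ h)
          ⬝ (exMap ⬝ v ⬝ u ⬝ (Lam Nat' fun k => Lam Nat' fun n => Leq (nth g k) (nth f n)) ⬝ h')))
    (Lam Brw fun _ => Lam HProp fun u => Lam (C .empty) fun e => Absurd (el u) e)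
    (Lam Brw fun x => Lam Brw fun y => Lam Brw fun z =>
      Lam HProp fun u => Lam HProp fun v => Lam HProp fun w =>
      Lam (Leq x y) fun _ => Lam (Leq y z) fun _ =>
      Lam (el u ⇒ el v) fun h => Lam (el v ⇒ el w) fun h' => Lam (el u) fun e => h' ⬝ (h ⬝ e))
    (Lam Brw fun x => Lam Brw fun y => Lam HProp fun u => Lam HProp fun v =>
      Lam (Leq x y) fun p => Lam (el u ⇒ el v) fun _ => Lam (Leq a x) fun q =>
      C .leqTrans ⬝ a ⬝ x ⬝ y ⬝ q ⬝ p)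
    (Lam Incr fun f => Lam Over fun u => Lam (IncrOver f u) fun _ =>
      Lam Brw fun x => Lam HProp fun v => Lam Nat' fun k => Lam (Leq x (nth f k)) fun _ =>
      Lam (el v ⇒ el (u ⬝ k)) fun h => Lam (el v) fun e =>
      ExIntro Nat' (fun k => el (u ⬝ k)) k (h ⬝ e))
    (Lam Incr fun f => Lam Over fun u => Lam (IncrOver f u) fun _ =>
      Lam Brw fun x => Lam HProp fun v => Lam (Pi Nat' fun k => Leq (nth f k) x) fun _ =>
      Lam (Pi Nat' fun k => el (u ⬝ k) ⇒ el v) fun h => Lam (some u) fun e =>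
      ExRec Nat' (fun k => el (u ⬝ k)) (el v) (elProp v) (fun k b => h ⬝ k ⬝ b) e)

/-! ### Inversion of strict inequalities, and induction for propositions -/

def LtZero (Q : Ex) : Ex := Q ⬝ C .bzero ⇒ C .empty
def LtSucc (a Q : Ex) : Ex := Pi Brw fun b => Q ⬝ (C .bsucc ⬝ b) ⇒ Leq a b
def LtLimit (Q : Ex) : Ex := Pi Incr fun f => Q ⬝ (C .blimit ⬝ f) ⇒
  Exist 0 Nat' fun k => Q ⬝ nth f k
def LtMono (Q : Ex) : Ex := Pi Brw fun b => Pi Brw fun c => Leq b c ⇒ Q ⬝ b ⇒ Q ⬝ c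
def LtSelf (a Q : Ex) : Ex := Leq a a ⇒ Q ⬝ (C .bsucc ⬝ a)

/-- There is a family `Q` with the properties of the predicate `a < x` that allow the inversion
of inequalities; stated as an elimination rule. -/
def invertLtTy : Ex := Pi Brw fun a => Pi (U 0) fun X =>
  (Pi (Brw ⇒ U 0) fun Q => LtZero Q ⇒ LtSucc a Q ⇒ LtLimit Q ⇒ LtMono Q ⇒ LtSelf a Q ⇒ X) ⇒ X
-- The recursion computes on point constructors, so all the clauses are identity functions except
-- monotonicity, which is `leqInd`. Reflexivity of `≤` is established only later, hence the premise
-- `a ≤ a` in `LtSelf`.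
def invertLtTm : Ex := Lam Brw fun a => Lam (U 0) fun X =>
  Lam (Pi (Brw ⇒ U 0) fun Q =>
    LtZero Q ⇒ LtSucc a Q ⇒ LtLimit Q ⇒ LtMono Q ⇒ LtSelf a Q ⇒ X) fun K =>
  let Q (x : Ex) : Ex := el (ltInd (.brwInd 1 0) a ⬝ x)
  K ⬝ Lam Brw Q ⬝ (Lam (C .empty) fun e => e)
    ⬝ (Lam Brw fun b => Lam (Leq a b) fun e => e)
    ⬝ (Lam Incr fun f => Lam (Exist 0 Nat' fun k => Q (nth f k)) fun e => e)
    ⬝ ltInd (.leqInd 1 0) a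
    ⬝ (Lam (Leq a a) fun e => e)

/-- Application of `invertLt`, where `r : a ≤ a`; the last argument of `K` derives `Q b` from
`a < b`. -/
def InvertLt (a r X : Ex) (K : Ex → Ex → Ex → Ex → (Ex → Ex → Ex) → Ex) : Ex :=
  bvar 14 ⬝ a ⬝ X ⬝ Lam (Brw ⇒ U 0) fun Q => Lam (LtZero Q) fun hz =>
    Lam (LtSucc a Q) fun hs => Lam (LtLimit Q) fun hl => Lam (LtMono Q) fun hm =>
    Lam (LtSelf a Q) fun h => K Q hz hs hl fun b p => hm ⬝ (C .bsucc ⬝ a) ⬝ b ⬝ p ⬝ (h ⬝ r)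

def propIndTy : Ex := Pi (Brw ⇒ U 0) fun B => (Pi Brw fun x => IsProp 0 (B ⬝ x)) ⇒
  B ⬝ C .bzero ⇒ (Pi Brw fun x => B ⬝ x ⇒ B ⬝ (C .bsucc ⬝ x)) ⇒
  (Pi Incr fun f => (Pi Nat' fun n => B ⬝ nth f n) ⇒ B ⬝ (C .blimit ⬝ f)) ⇒ Pi Brw fun x => B ⬝ x
-- The motive over `≤` is taken to be `≤` itself, so its methods are the constructors of `≤`. The
-- `bisim` method is immediate for a family of propositions.
def propIndTm : Ex := Lam (Brw ⇒ U 0) fun B => Lam (Pi Brw fun x => IsProp 0 (B ⬝ x)) fun hB =>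
  Lam (B ⬝ C .bzero) fun mz => Lam (Pi Brw fun x => B ⬝ x ⇒ B ⬝ (C .bsucc ⬝ x)) fun ms =>
  Lam (Pi Incr fun f => (Pi Nat' fun n => B ⬝ nth f n) ⇒ B ⬝ (C .blimit ⬝ f)) fun ml =>
  let Over (f : Ex) : Ex := Pi Nat' fun n => B ⬝ nth f n
  let IncrOver (f : Ex) : Ex := IsIncr (Seq' f)
  let SimOver (f g : Ex) : Ex := Pi Nat' fun k => Exist 0 Nat' fun n =>
    Sig 0 (Leq (nth f k) (nth g n)) fun _ => Leq (nth f k) (nth g n)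
  indAp (.brwInd 0 0) B
    (Lam Brw fun x => Lam Brw fun y => Lam (B ⬝ x) fun _ => Lam (B ⬝ y) fun _ =>
      Lam (Leq x y) fun _ => Leq x y)
    (Lam Brw fun x => setOfProp ⬝ (B ⬝ x) ⬝ (hB ⬝ x))
    (Lam Brw fun x => Lam Brw fun y => Lam (B ⬝ x) fun _ => Lam (B ⬝ y) fun _ =>
      Lam (Leq x y) fun _ => C .leqProp ⬝ x ⬝ y)
    mz ms
    (Lam Incr fun f => Lam (Over f) fun u => Lam (IncrOver f) fun _ => ml ⬝ f ⬝ u)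
    (Lam Incr fun f => Lam (Over f) fun u => Lam (IncrOver f) fun _ =>
      Lam Incr fun g => Lam (Over g) fun v => Lam (IncrOver g) fun _ =>
      Lam (Bisim f g) fun s => Lam (SimOver f g) fun _ => Lam (SimOver g f) fun _ =>
      hB ⬝ (C .blimit ⬝ g)
        ⬝ Transport 0 0 Brw B (C .blimit ⬝ f) (C .blimit ⬝ g) (C .bisim ⬝ f ⬝ g ⬝ s) (ml ⬝ f ⬝ u)
        ⬝ (ml ⬝ g ⬝ v))
    (Lam Brw fun x => Lam (B ⬝ x) fun _ => C .leqZero ⬝ x)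
    (Lam Brw fun x => Lam Brw fun y => Lam Brw fun z =>
      Lam (B ⬝ x) fun _ => Lam (B ⬝ y) fun _ => Lam (B ⬝ z) fun _ =>
      Lam (Leq x y) fun _ => Lam (Leq y z) fun _ => C .leqTrans ⬝ x ⬝ y ⬝ z)
    (Lam Brw fun x => Lam Brw fun y => Lam (B ⬝ x) fun _ => Lam (B ⬝ y) fun _ =>
      Lam (Leq x y) fun _ => C .leqSuccMono ⬝ x ⬝ y)
    (Lam Incr fun f => Lam (Over f) fun _ => Lam (IncrOver f) fun _ =>
      Lam Brw fun x => Lam (B ⬝ x) fun _ => Lam Nat' fun k => Lam (Leq x (nth f k)) fun _ =>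
      C .leqCocone ⬝ f ⬝ x ⬝ k)
    (Lam Incr fun f => Lam (Over f) fun _ => Lam (IncrOver f) fun _ =>
      Lam Brw fun x => Lam (B ⬝ x) fun _ => Lam (Pi Nat' fun k => Leq (nth f k) x) fun _ =>
      C .leqLimiting ⬝ f ⬝ x)
/-- Induction on Brouwer trees for a family of propositions. -/
def PropInd (B : Ex → Ex) (hB : Ex → Ex) (mz : Ex) (ms : Ex → Ex → Ex) (ml : Ex → Ex → Ex) : Ex :=
  bvar 15 ⬝ Lam Brw B ⬝ Lam Brw hB ⬝ mz ⬝ (Lam Brw fun x => Lam (B x) fun h => ms x h)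
    ⬝ Lam Incr fun f => Lam (Pi Nat' fun n => B (nth f n)) fun h => ml f h

/-! ### The order of Brouwer trees -/

def iotaSeq : Ex := Pair 0 (Nat' ⇒ Brw) IsIncr iota iotaIncr
def Trans (x y z p q : Ex) : Ex := C .leqTrans ⬝ x ⬝ y ⬝ z ⬝ p ⬝ q
def Mono (x y p : Ex) : Ex := C .leqSuccMono ⬝ x ⬝ y ⬝ p
def Cocone (f x k p : Ex) : Ex := C .leqCocone ⬝ f ⬝ x ⬝ k ⬝ p
def Limiting (f x : Ex) (h : Ex → Ex) : Ex := C .leqLimiting ⬝ f ⬝ x ⬝ Lam Nat' h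
def Succ (x : Ex) : Ex := C .bsucc ⬝ x
def Limit (f : Ex) : Ex := C .blimit ⬝ f

def leqReflTy : Ex := Pi Brw fun x => Leq x x
def leqReflTm : Ex := PropInd (fun x => Leq x x) (fun x => C .leqProp ⬝ x ⬝ x)
  (C .leqZero ⬝ C .bzero) (fun x h => Mono x x h)
  fun f h => Limiting f (Limit f) fun k => Cocone f (nth f k) k (h ⬝ k)
def leqRefl : Ex := bvar 16

def iotaIrreflTy : Ex := Pi Nat' fun n => Lt (iota ⬝ n) (iota ⬝ n) ⇒ C .empty
def iotaIrreflTm : Ex := Lam Nat' fun n =>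
  NatRec (fun n => Lt (iota ⬝ n) (iota ⬝ n) ⇒ C .empty)
    (Lam (Lt (iota ⬝ C .zero) (iota ⬝ C .zero)) fun p =>
      InvertLt (iota ⬝ C .zero) (leqRefl ⬝ (iota ⬝ C .zero)) (C .empty)
        fun _ hz _ _ h => hz ⬝ h (iota ⬝ C .zero) p)
    (fun n ih => Lam (Lt (iota ⬝ S n) (iota ⬝ S n)) fun p =>
      InvertLt (iota ⬝ S n) (leqRefl ⬝ (iota ⬝ S n)) (C .empty)
        -- Inverting `ι (n + 1) < succ (ι n)` gives `ι (n + 1) ≤ ι n`, which is judgementally `ι n <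
        -- ι n`.
        fun _ _ hs _ h => ih ⬝ (hs ⬝ (iota ⬝ n) ⬝ h (iota ⬝ S n) p)) n
def iotaIrrefl : Ex := bvar 17

def iotaLeOmegaTy : Ex := Pi Nat' fun n => Leq (iota ⬝ n) omega
def iotaLeOmegaTm : Ex := Lam Nat' fun n =>
  Cocone iotaSeq (iota ⬝ n) n (leqRefl ⬝ (iota ⬝ n))
def iotaLeOmega : Ex := bvar 18

def omegaIrreflTy : Ex := Lt omega omega ⇒ C .empty
-- Inverting `ω < limit ι` gives `ω < ι k` for some `k`. This fails for `k = 0`, and for a successor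
-- it yields `ι (k + 1) ≤ ω ≤ ι k`.
def omegaIrreflTm : Ex := Lam (Lt omega omega) fun p =>
  InvertLt omega (leqRefl ⬝ omega) (C .empty) fun Q hz hs hl h =>
  ExRec Nat' (fun k => Q ⬝ nth iotaSeq k) (C .empty) propEmpty
    (fun k e => NatRec (fun k => Q ⬝ (iota ⬝ k) ⇒ C .empty) hz
      (fun k _ => Lam (Q ⬝ (iota ⬝ S k)) fun e => iotaIrrefl ⬝ k ⬝
        Trans (iota ⬝ S k) omega (iota ⬝ k) (iotaLeOmega ⬝ S k) (hs ⬝ (iota ⬝ k) ⬝ e)) k ⬝ e)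
    (hl ⬝ iotaSeq ⬝ h omega p)
def omegaIrrefl : Ex := bvar 19

def iotaLeTy : Ex := Pi Incr fun f => Pi Nat' fun k => Leq (iota ⬝ k) (nth f k)
def iotaLeTm : Ex := Lam Incr fun f => Lam Nat' fun k =>
  NatRec (fun k => Leq (iota ⬝ k) (nth f k)) (C .leqZero ⬝ nth f (C .zero))
    (fun k h => Trans (iota ⬝ S k) (Succ (nth f k)) (nth f (S k)) (Mono (iota ⬝ k) (nth f k) h)
      (incrAt f k)) k
def iotaLe : Ex := bvar 20

def omegaLeLimitTy : Ex := Pi Incr fun f => Leq omega (Limit f)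
def omegaLeLimitTm : Ex := Lam Incr fun f =>
  Limiting iotaSeq (Limit f) fun k => Cocone f (iota ⬝ k) k (iotaLe ⬝ f ⬝ k)
def omegaLeLimit : Ex := bvar 21

def omegaLeSuccTy : Ex := Pi Brw fun x => Leq omega x ⇒ Leq omega (Succ x)
-- Comparing term by term, `ι (k + 1) ≤ succ x` follows from `ι k ≤ x`; the general fact `x ≤ succ
-- x` is not needed.
def omegaLeSuccTm : Ex := Lam Brw fun x => Lam (Leq omega x) fun h =>
  Limiting iotaSeq (Succ x) fun k => NatRec (fun k => Leq (iota ⬝ k) (Succ x)) (C .leqZero ⬝ Succ x)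
    (fun k _ => Mono (iota ⬝ k) x (Trans (iota ⬝ k) omega x (iotaLeOmega ⬝ k) h)) k
def omegaLeSucc : Ex := bvar 22

/-! ### Finite and infinite Brouwer trees -/

/-- `x ≤ ι n` for some `n` -/
def Fin' (x : Ex) : Ex := Exist 0 Nat' fun n => Leq x (iota ⬝ n)
/-- Elimination of a proof that `x` is finite into a proposition. -/
def FinRec (x P hP : Ex) (u : Ex → Ex → Ex) (e : Ex) : Ex :=
  ExRec Nat' (fun n => Leq x (iota ⬝ n)) P hP u e
def FinIntro (x n p : Ex) : Ex := ExIntro Nat' (fun n => Leq x (iota ⬝ n)) n p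
def FinProp (x : Ex) : Ex := ExProp Nat' fun n => Leq x (iota ⬝ n)
def FinOrInf (x : Ex) : Ex := Sum' 0 (Fin' x) (Leq omega x)
def FinOrInfRec (x : Ex) (P : Ex → Ex) (u v : Ex → Ex) (z : Ex) : Ex :=
  SumRec (Fin' x) (Leq omega x) P u v z

def finOrInfTy : Ex := Pi Brw fun x => FinOrInf x
-- The two alternatives exclude each other, since `ω ≤ x ≤ ι n` contradicts `ι (n + 1) ≤ ω`. The sum
-- is therefore a proposition, and induction reaches it without truncation.
def finOrInfTm : Ex :=
  PropInd FinOrInf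
    (fun x => propSum ⬝ Fin' x ⬝ Leq omega x ⬝ FinProp x ⬝ (C .leqProp ⬝ omega ⬝ x)
      ⬝ Lam (Fin' x) fun e => Lam (Leq omega x) fun h =>
        FinRec x (C .empty) propEmpty (fun n p => iotaIrrefl ⬝ n ⬝
          Trans (iota ⬝ S n) omega (iota ⬝ n) (iotaLeOmega ⬝ S n) (Trans omega x (iota ⬝ n) h p)) e)
    (Inl (Fin' (C .bzero)) (Leq omega (C .bzero))
      (FinIntro (C .bzero) (C .zero) (C .leqZero ⬝ (iota ⬝ C .zero))))
    (fun x z => FinOrInfRec x (fun _ => FinOrInf (Succ x))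
      (fun e => Inl (Fin' (Succ x)) (Leq omega (Succ x))
        (FinRec x (Fin' (Succ x)) (FinProp (Succ x))
          (fun n p => FinIntro (Succ x) (S n) (Mono x (iota ⬝ n) p)) e))
      (fun h => Inr (Fin' (Succ x)) (Leq omega (Succ x)) (omegaLeSucc ⬝ x ⬝ h)) z)
    (fun f _ => Inr (Fin' (Limit f)) (Leq omega (Limit f)) (omegaLeLimit ⬝ f))
def finOrInf : Ex := bvar 23

def ttNeFfTy : Ex := Eq' 0 (C .two) (C .tt) (C .ff) ⇒ C .empty
-- Large elimination: a family that is empty at `ff` and is the natural numbers at `tt` would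
-- transport an element into the empty type.
def ttNeFfTm : Ex := Lam (Eq' 0 (C .two) (C .tt) (C .ff)) fun e =>
  Tr 0 0 (C .two) (fun b => C (.twoInd 1) ⬝ Lam (C .two) (fun _ => U 0) ⬝ C .empty ⬝ Nat' ⬝ b)
    (C .tt) (C .ff) e (C .zero)
def ttNeFf : Ex := bvar 24

def neOmegaTy : Ex := Pi Brw fun x => Lt x omega ⇒ Not' (Eq' 0 Brw x omega)
def neOmegaTm : Ex := Lam Brw fun x => Lam (Lt x omega) fun h => Lam (Eq' 0 Brw x omega) fun e =>
  omegaIrrefl ⬝ Tr 0 0 Brw (fun z => Lt z omega) x omega e h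
def neOmega : Ex := bvar 25

/-- `ff` if `z` says that `x` is finite, and `tt` otherwise -/
def isInf (x z : Ex) : Ex :=
  FinOrInfRec x (fun _ => C .two) (fun _ => C .ff) (fun _ => C .tt) z

/-- The alternative `z` is a variable, rather than `finOrInf` applied to `x`, so that case analysis
on it makes `isInf` compute. -/
def finOfIsInfTy : Ex := Pi Brw fun x => Pi (FinOrInf x) fun z =>
  Eq' 0 (C .two) (isInf x z) (C .ff) ⇒ Fin' x
def finOfIsInfTm : Ex := Lam Brw fun x => Lam (FinOrInf x) fun z =>
  FinOrInfRec x (fun z => Eq' 0 (C .two) (isInf x z) (C .ff) ⇒ Fin' x)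
    (fun e => Lam (Eq' 0 (C .two) (C .ff) (C .ff)) fun _ => e)
    (fun _ => Lam (Eq' 0 (C .two) (C .tt) (C .ff)) fun h => Absurd (Fin' x) (ttNeFf ⬝ h)) z
def finOfIsInf : Ex := bvar 26

def isInfOfNotTy : Ex := Pi Brw fun x => Pi (FinOrInf x) fun z =>
  Not' (Leq omega x) ⇒ Eq' 0 (C .two) (isInf x z) (C .ff)
def isInfOfNotTm : Ex := Lam Brw fun x => Lam (FinOrInf x) fun z =>
  FinOrInfRec x (fun z => Not' (Leq omega x) ⇒ Eq' 0 (C .two) (isInf x z) (C .ff))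
    (fun _ => Lam (Not' (Leq omega x)) fun _ => Refl 0 (C .two) (C .ff))
    (fun h => Lam (Not' (Leq omega x)) fun n =>
      Absurd (Eq' 0 (C .two) (C .tt) (C .ff)) (n ⬝ h)) z
def isInfOfNot : Ex := bvar 27

/-- A limit of a sequence of finite trees is `ω`. -/
def limitEqOmegaTy : Ex := Pi Incr fun f => (Pi Nat' fun k => Fin' (nth f k)) ⇒
  Eq' 0 Brw (Limit f) omega
def limitEqOmegaTm : Ex := Lam Incr fun f => Lam (Pi Nat' fun k => Fin' (nth f k)) fun h =>
  -- Finiteness of all `f k` is judgementally the simulation of `f` by `ι`.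
  C .bisim ⬝ f ⬝ iotaSeq ⬝ Pair 0 (Sim f iotaSeq) (fun _ => Sim iotaSeq f) h
    (Lam Nat' fun k => ExIntro Nat' (fun n => Leq (iota ⬝ k) (nth f n)) k (iotaLe ⬝ f ⬝ k))
def limitEqOmega : Ex := bvar 28

/-- If a limit is `ω`, then nothing that lies above `ω` lies strictly below a term of the
sequence. -/
def notLtNthTy : Ex := Pi Incr fun f => Eq' 0 Brw (Limit f) omega ⇒ Pi Nat' fun k =>
  Not' (Lt omega (nth f k))
def notLtNthTm : Ex := Lam Incr fun f => Lam (Eq' 0 Brw (Limit f) omega) fun e =>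
  Lam Nat' fun k => Lam (Lt omega (nth f k)) fun h =>
  omegaIrrefl ⬝ Tr 0 0 Brw (fun z => Lt omega z) (Limit f) omega e (Cocone f (Succ omega) k h)
def notLtNth : Ex := bvar 29

/-! ### Deciding equality with `ω` from `WLPO` -/

def EqOmega (x : Ex) : Ex := Eq' 0 Brw x omega
def Yes (x h : Ex) : Ex := Inl (EqOmega x) (Not' (EqOmega x)) h
def No (x h : Ex) : Ex := Inr (EqOmega x) (Not' (EqOmega x)) h
/-- `s n = ff` for all `n` -/
def AllFf (s : Ex) : Ex := Pi Nat' fun n => Eq' 0 (C .two) (s ⬝ n) (C .ff)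

def decLimitTy : Ex := WLPO ⇒ Pi Incr fun f => Dec 0 (EqOmega (Limit f))
def decLimitTm : Ex := Lam WLPO fun w => Lam Incr fun f =>
  let s : Ex := Lam Nat' fun k => isInf (nth f k) (finOrInf ⬝ nth f k)
  SumRec (AllFf s) (Not' (AllFf s)) (fun _ => Dec 0 (EqOmega (Limit f)))
    (fun h => Yes (Limit f) (limitEqOmega ⬝ f ⬝ Lam Nat' fun k =>
      finOfIsInf ⬝ nth f k ⬝ (finOrInf ⬝ nth f k) ⬝ (h ⬝ k)))
    (fun n => No (Limit f) (Lam (EqOmega (Limit f)) fun e => n ⬝ Lam Nat' fun k =>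
      isInfOfNot ⬝ nth f k ⬝ (finOrInf ⬝ nth f k) ⬝ Lam (Leq omega (nth f k)) fun h =>
        -- The index moves to `k + 1` to turn `ω ≤ f k` into the strict `ω < f (k + 1)`.
        notLtNth ⬝ f ⬝ e ⬝ S k
          ⬝ Trans (Succ omega) (Succ (nth f k)) (nth f (S k)) (Mono omega (nth f k) h)
            (incrAt f k)))
    (w ⬝ s)
def decLimit : Ex := bvar 30

def decEqOmegaOfWLPOTy : Ex := WLPO ⇒ DecEqOmega
def decEqOmegaOfWLPOTm : Ex := Lam WLPO fun w =>
  PropInd (fun x => Dec 0 (EqOmega x))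
    (fun x => propSum ⬝ EqOmega x ⬝ Not' (EqOmega x) ⬝ (C .brwSet ⬝ x ⬝ omega)
      ⬝ propPi (EqOmega x) (fun _ => C .empty) (fun _ => propEmpty)
      ⬝ Lam (EqOmega x) fun e => Lam (Not' (EqOmega x)) fun n => n ⬝ e)
    (No (C .bzero) (neOmega ⬝ C .bzero ⬝ (iotaLeOmega ⬝ S (C .zero))))
    -- The successor of a finite tree is below `ω`, that of an infinite one above it, strictly in
    -- both cases.
    (fun x _ => No (Succ x) (FinOrInfRec x (fun _ => Not' (EqOmega (Succ x)))
      (fun e => neOmega ⬝ Succ x ⬝ FinRec x (Lt (Succ x) omega)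
        (C .leqProp ⬝ Succ (Succ x) ⬝ omega)
        (fun n p => Trans (Succ (Succ x)) (iota ⬝ S (S n)) omega
          (Mono (Succ x) (iota ⬝ S n) (Mono x (iota ⬝ n) p)) (iotaLeOmega ⬝ S (S n))) e)
      (fun h => Lam (EqOmega (Succ x)) fun e => omegaIrrefl ⬝
        Tr 0 0 Brw (fun z => Lt omega z) (Succ x) omega e (Mono omega x h))
      (finOrInf ⬝ x)))
    (fun f _ => decLimit ⬝ w ⬝ f)
def decEqOmegaOfWLPO : Ex := bvar 31

/-! ### The sequence that jumps to `ω` when a binary sequence takes the value `tt` -/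

/-- `ω + k` -/
def omegaAdd (k : Ex) : Ex := NatRec (fun _ => Brw) omega (fun _ x => Succ x) k
/-- `y` if `b` is `ff`, and `ω + k` if `b` is `tt` -/
def select (k y b : Ex) : Ex := TwoRec (fun _ => Brw) y (omegaAdd k) b
/-- The sequence `k ↦ k` as long as `s` takes the value `ff`, jumping to `ω + k + 1` wherever `s`
takes the value `tt`. -/
def jump (s k : Ex) : Ex :=
  NatRec (fun _ => Brw) (C .bzero) (fun k y => Succ (select k y (s ⬝ k))) k
def BinSeq : Ex := Nat' ⇒ C .two

def omegaLeOmegaAddTy : Ex := Pi Nat' fun k => Leq omega (omegaAdd k)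
def omegaLeOmegaAddTm : Ex := Lam Nat' fun k =>
  NatRec (fun k => Leq omega (omegaAdd k)) (leqRefl ⬝ omega)
    (fun k h => omegaLeSucc ⬝ omegaAdd k ⬝ h) k
def omegaLeOmegaAdd : Ex := bvar 32

/-- Jumping to `ω + k` rather than to `ω` keeps the sequence increasing even if `s` takes the value
`tt` repeatedly: by this bound, the selected value never falls below the current one. -/
def jumpLeTy : Ex := Pi BinSeq fun s => Pi Nat' fun k => Leq (jump s k) (omegaAdd k)
def jumpLeTm : Ex := Lam BinSeq fun s => Lam Nat' fun k =>
  NatRec (fun k => Leq (jump s k) (omegaAdd k)) (C .leqZero ⬝ omega)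
    (fun k h => Mono (select k (jump s k) (s ⬝ k)) (omegaAdd k)
      (TwoRec (fun b => Leq (select k (jump s k) b) (omegaAdd k)) h
        (leqRefl ⬝ omegaAdd k) (s ⬝ k))) k
def jumpLe : Ex := bvar 33

def jumpIncrTy : Ex := Pi BinSeq fun s => IsIncr (Lam Nat' fun k => jump s k)
def jumpIncrTm : Ex := Lam BinSeq fun s => Lam Nat' fun k =>
  Mono (jump s k) (select k (jump s k) (s ⬝ k))
    (TwoRec (fun b => Leq (jump s k) (select k (jump s k) b)) (leqRefl ⬝ jump s k)
      (jumpLe ⬝ s ⬝ k) (s ⬝ k))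
def jumpSeq (s : Ex) : Ex :=
  Pair 0 (Nat' ⇒ Brw) IsIncr (Lam Nat' fun k => jump s k) (bvar 34 ⬝ s)

def jumpLeIotaTy : Ex := Pi BinSeq fun s => AllFf s ⇒ Pi Nat' fun k => Leq (jump s k) (iota ⬝ k)
def jumpLeIotaTm : Ex := Lam BinSeq fun s => Lam (AllFf s) fun h => Lam Nat' fun k =>
  NatRec (fun k => Leq (jump s k) (iota ⬝ k)) (C .leqZero ⬝ C .bzero)
    (fun k ih => Mono (select k (jump s k) (s ⬝ k)) (iota ⬝ k)
      -- The equation `b = ff` is put into the motive, so that the case `tt` can be refuted.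
      (TwoRec (fun b => Eq' 0 (C .two) b (C .ff) ⇒ Leq (select k (jump s k) b) (iota ⬝ k))
        (Lam (Eq' 0 (C .two) (C .ff) (C .ff)) fun _ => ih)
        (Lam (Eq' 0 (C .two) (C .tt) (C .ff)) fun e =>
          Absurd (Leq (omegaAdd k) (iota ⬝ k)) (ttNeFf ⬝ e)) (s ⬝ k) ⬝ (h ⬝ k))) k
def jumpLeIota : Ex := bvar 35

def eqFfTy : Ex := Pi BinSeq fun s => EqOmega (Limit (jumpSeq s)) ⇒ AllFf s
def eqFfTm : Ex := Lam BinSeq fun s => Lam (EqOmega (Limit (jumpSeq s))) fun e => Lam Nat' fun k =>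
  let N (b : Ex) : Ex := Not' (Lt omega (Succ (select k (jump s k) b)))
  TwoRec (fun b => N b ⇒ Eq' 0 (C .two) b (C .ff))
    (Lam (N (C .ff)) fun _ => Refl 0 (C .two) (C .ff))
    (Lam (N (C .tt)) fun n => Absurd (Eq' 0 (C .two) (C .tt) (C .ff))
      (n ⬝ Mono omega (omegaAdd k) (omegaLeOmegaAdd ⬝ k)))
    -- Term `k + 1` is the one that depends on `s k`; if that value were `tt`, the term would be `ω
    -- + k + 1`, strictly above `ω`.
    (s ⬝ k) ⬝ (notLtNth ⬝ jumpSeq s ⬝ e ⬝ S k)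
def eqFf : Ex := bvar 36

def wlpoOfDecEqOmegaTy : Ex := DecEqOmega ⇒ WLPO
def wlpoOfDecEqOmegaTm : Ex := Lam DecEqOmega fun d => Lam BinSeq fun s =>
  let E : Ex := EqOmega (Limit (jumpSeq s))
  SumRec E (Not' E) (fun _ => Sum' 0 (AllFf s) (Not' (AllFf s)))
    (fun e => Inl (AllFf s) (Not' (AllFf s)) (eqFf ⬝ s ⬝ e))
    (fun n => Inr (AllFf s) (Not' (AllFf s)) (Lam (AllFf s) fun h => n ⬝
      (limitEqOmega ⬝ jumpSeq s ⬝ Lam Nat' fun k =>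
        FinIntro (jump s k) k (jumpLeIota ⬝ s ⬝ h ⬝ k))))
    (d ⬝ Limit (jumpSeq s))
def wlpoOfDecEqOmega : Ex := bvar 37

def wlpoIffTm : Ex := Pair 0 (WLPO ⇒ DecEqOmega) (fun _ => DecEqOmega ⇒ WLPO)
  decEqOmegaOfWLPO wlpoOfDecEqOmega

/-! ### Checking the whole development -/

/-- The types proved above, with their proofs, each in the context of the types before it. -/
def library : List (Ex × Ex) :=
  [(setOfRelTy 0, setOfRelTm 0), (setOfRelTy 1, setOfRelTm 1), (setOfPropTy, setOfPropTm),
   (propPiTy, propPiTm), (propIsPropTy, propIsPropTm), (propUpTy, propUpTm),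
   (propEmptyTy, propEmptyTm), (propSumTy, propSumTm), (propUnivTy, propUnivTm),
   (mkPropEqTy, mkPropEqTm), (propExtTy, propExtTm), (setHPropTy, setHPropTm),
   (transportConstTy, transportConstTm), (exMapTy, exMapTm), (invertLtTy, invertLtTm),
   (propIndTy, propIndTm), (leqReflTy, leqReflTm), (iotaIrreflTy, iotaIrreflTm),
   (iotaLeOmegaTy, iotaLeOmegaTm), (omegaIrreflTy, omegaIrreflTm), (iotaLeTy, iotaLeTm),
   (omegaLeLimitTy, omegaLeLimitTm), (omegaLeSuccTy, omegaLeSuccTm), (finOrInfTy, finOrInfTm),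
   (ttNeFfTy, ttNeFfTm), (neOmegaTy, neOmegaTm), (finOfIsInfTy, finOfIsInfTm),
   (isInfOfNotTy, isInfOfNotTm), (limitEqOmegaTy, limitEqOmegaTm), (notLtNthTy, notLtNthTm),
   (decLimitTy, decLimitTm), (decEqOmegaOfWLPOTy, decEqOmegaOfWLPOTm),
   (omegaLeOmegaAddTy, omegaLeOmegaAddTm), (jumpLeTy, jumpLeTm), (jumpIncrTy, jumpIncrTm),
   (jumpLeIotaTy, jumpLeIotaTm), (eqFfTy, eqFfTm), (wlpoOfDecEqOmegaTy, wlpoOfDecEqOmegaTm),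
   (Iff' 0 WLPO DecEqOmega, wlpoIffTm)]

theorem library_derivesAll : derivesAll 0 [] library = true := by decide +kernel

theorem wlpoIff_closed : ((Iff' 0 WLPO DecEqOmega 38).closedAt 0 &&
    (Iff' 0 WLPO DecEqOmega 38).beq (Iff' 0 WLPO DecEqOmega 0)) = true := by decide +kernel

end HoTT

theorem theorem49 : HoTT.Holds (HoTT.Iff' 0 HoTT.WLPO HoTT.DecEqOmega) := by
  obtain ⟨h₁, h₂⟩ := Bool.and_eq_true_iff.mp HoTT.wlpoIff_closed
  -- The statement is entry `38`, the last of `library`, and so is written at depth `38`; `h₂`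
  -- identifies it with the statement at the root.
  obtain ⟨u, hu⟩ := HoTT.Realizes.nil.of_derivesAll HoTT.library_derivesAll 38 rfl h₁
  exact ⟨u, HoTT.Tm.eq_of_beq h₂ ▸ hu⟩
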